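/- Let $k\ge 1$ and $l=4k+4$, and let $\{P_0,P_1,P_2,P_3\}$ be a symmetric Clifford system on $\mathbb{R}^{2l}$, i.e. the $P_\alpha$ are symmetric with $P_\alpha P_\beta+P_\beta P_\alpha=2\delta_{\alpha\beta}I_{2l}$. Let $F(x)=|x|^4-2\sum_{\alpha=0}^{3}\langle P_\alpha x,x\rangle^2$, and let $M_1=\{x\in S^{2l-1} : F(x)=1\}$ be the corresponding focal submanifold of OT-FKM type, with multiplicities $(m_1,m_2)=(3,l-4)=(3,4k)$, endowed with the Riemannian metric induced from $\mathbb{R}^{2l}$. Let $\Sigma$ be the unit sphere of $\mathrm{Span}\{P_0,\dots,P_3\}$, for the inner product in which the $P_\alpha$ are orthonormal, and let $$\Omega=\{x\in M_1 : \text{there are orthonormal } Q_0,\dots,Q_3\in\Sigma \text{ with } Q_0Q_1Q_2Q_3x=x\}.$$ For $x\in M_1$ let $T_x^{\perp}M_1$ be the normal space of $M_1$ in $S^{2l-1}$, let $A_N$ be the shape operator of $M_1\subset S^{2l-1}$ in the direction $N\in T_x^\perp M_1$, and write $\rho(X)$ for the Ricci curvature of $M_1$ in the direction of a unit tangent vector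 $X$. Then: 1. $M_1$ is a smooth submanifold of dimension $2l-5$, and it is not intrinsically homogeneous: the isometry group of the Riemannian manifold $M_1$ does not act transitively on $M_1$. 2. The maximum of $\rho(X)$ over all unit tangent vectors $X$ of $M_1$ is $2l-6$. For $x\in M_1$, there is a unit vector $X\in T_xM_1$ with $\rho(X)=2l-6$ if and only if $x\in\Omega$. 3. $\Omega\neq\emptyset$ and $\Omega\subsetneq M_1$. 4. $\Omega$ is the set of all $x\in M_1$ for which there are orthonormal $N_0,\dots,N_3\in T^\perp_xM_1$ with $\dim\bigcap_{i=0}^3\mathrm{Ker}\,A_{N_i}\ge 3$. 5. For every $x\in M_1$ and all orthonormal $N_0,\dots,N_3\in T^\perp_xM_1$ one has $\dim\bigcap_{i=0}^3\mathrm{Ker}\,A_{N_i}\le 3$. If $x\in\Omega$, this dimension is $3$, and a unit vector $X\in T_xM_1$ satisfies $\rho(X)=2l-6$ if and only if $X\in\bigcap_{i=0}^3\mathrm{Ker}\,A_{N_i}$. -/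

import Mathlib

open Set Topology
open scoped ContDiff

noncomputable section

namespace OTFKM

/-! ### Riemannian geometry in local coordinates -/

/-- The partial derivative `∂ᵢ F` of a function of `n` real variables. -/
def pd {n : ℕ} {F : Type*} [NormedAddCommGroup F] [NormedSpace ℝ F]
    (i : Fin n) (f : (Fin n → ℝ) → F) (u : Fin n → ℝ) : F :=
  fderiv ℝ f u (Pi.single i 1)

/-- The Christoffel symbol `Γᵏᵢⱼ = ½ ∑ₗ gᵏˡ (∂ᵢ gⱼₗ + ∂ⱼ gᵢₗ - ∂ₗ gᵢⱼ)` of the Levi-Civita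
connection of a Riemannian metric `g` given in coordinates. -/
def christoffel {n : ℕ} (g : (Fin n → ℝ) → Matrix (Fin n) (Fin n) ℝ)
    (k i j : Fin n) (u : Fin n → ℝ) : ℝ :=
  (1 / 2 : ℝ) * ∑ l, (g u)⁻¹ k l *
    (pd i (fun w => g w j l) u + pd j (fun w => g w i l) u - pd l (fun w => g w i j) u)

/-- The curvature component `Rˡₖᵢⱼ`, i.e. the `l`-th component of
`∇ᵢ∇ⱼ∂ₖ - ∇ⱼ∇ᵢ∂ₖ`, of a Riemannian metric `g` given in coordinates. -/
def riemann {n : ℕ} (g : (Fin n → ℝ) → Matrix (Fin n) (Fin n) ℝ)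
    (l k i j : Fin n) (u : Fin n → ℝ) : ℝ :=
  pd i (christoffel g l j k) u - pd j (christoffel g l i k) u
    + ∑ p, (christoffel g l i p u * christoffel g p j k u
      - christoffel g l j p u * christoffel g p i k u)

/-- The component `Ric_{jk} = ∑ᵢ Rⁱₖᵢⱼ` of the Ricci tensor (positive on round spheres). -/
def ricciTensor {n : ℕ} (g : (Fin n → ℝ) → Matrix (Fin n) (Fin n) ℝ)
    (j k : Fin n) (u : Fin n → ℝ) : ℝ :=
  ∑ i, riemann g i k i j u

/-! ### Embedded submanifolds of a Euclidean space -/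

variable {E : Type*} [NormedAddCommGroup E] [InnerProductSpace ℝ E]

/-- The metric `gᵢⱼ = ⟨∂ᵢφ, ∂ⱼφ⟩` induced by a map `φ` into a Euclidean space. -/
def inducedMetric {n : ℕ} (φ : (Fin n → ℝ) → E) (u : Fin n → ℝ) : Matrix (Fin n) (Fin n) ℝ :=
  Matrix.of fun i j => inner ℝ (pd i φ u) (pd j φ u)

/-- `φ`, restricted to the open set `U ⊆ ℝⁿ`, is a smooth local parametrization of `M`: a smooth
immersion which is a homeomorphism of `U` onto a relatively open subset of `M`. -/
structure IsLocalParam (n : ℕ) (M : Set E) (φ : (Fin n → ℝ) → E) (U : Set (Fin n → ℝ)) :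
    Prop where
  isOpen : IsOpen U
  contDiffOn : ContDiffOn ℝ ∞ φ U
  immersion : ∀ u ∈ U, Function.Injective (fderiv ℝ φ u)
  isEmbedding : IsEmbedding (U.domRestrict φ)
  isOpen_image : ∃ W : Set E, IsOpen W ∧ φ '' U = M ∩ W

/-- `M` is a smooth embedded submanifold of dimension `n`. -/
def IsSmoothSubmanifold (n : ℕ) (M : Set E) : Prop :=
  ∀ x ∈ M, ∃ φ U, IsLocalParam n M φ U ∧ x ∈ φ '' U

/-- The tangent space of `M` at `x`, spanned by the velocities of smooth curves in `M`. -/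
def tangentSpace (M : Set E) (x : E) : Submodule ℝ E :=
  Submodule.span ℝ {X | ∃ γ : ℝ → E, ContDiffAt ℝ ∞ γ 0 ∧ (∀ᶠ t in 𝓝 0, γ t ∈ M) ∧
    γ 0 = x ∧ deriv γ 0 = X}

open Classical in
/-- The intrinsic Ricci curvature `ρ(X) = Ric(X, X)` of the `n`-dimensional submanifold `M`, with
its induced metric, at `x ∈ M` in the direction of the tangent vector `X`, computed in a local
parametrization in which `x = φ(u)` and `X = dφ_u(v)`. The choice of the parametrization does not
matter because `Ric` is a tensor; the default `0` is used only if `X` is not tangent to `M`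
at a point `x` of `M`. -/
def ricciCurvature (n : ℕ) (M : Set E) (x X : E) : ℝ :=
  if h : ∃ q : ((Fin n → ℝ) → E) × Set (Fin n → ℝ) × (Fin n → ℝ) × (Fin n → ℝ),
      IsLocalParam n M q.1 q.2.1 ∧ q.2.2.1 ∈ q.2.1 ∧ q.1 q.2.2.1 = x ∧
        fderiv ℝ q.1 q.2.2.1 q.2.2.2 = X
  then ∑ j, ∑ k, h.choose.2.2.2 j * h.choose.2.2.2 k *
    ricciTensor (inducedMetric h.choose.1) j k h.choose.2.2.1
  else 0

/-- Smoothness of a map on the submanifold `M`, tested in local parametrizations. -/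
def SmoothOnSubmanifold (n : ℕ) (M : Set E) (f : E → E) : Prop :=
  ∀ φ U, IsLocalParam n M φ U → ContDiffOn ℝ ∞ (f ∘ φ) U

/-- `f` restricts to an isometry of the Riemannian manifold `M` (with its induced metric): a
diffeomorphism of `M` onto itself which preserves the metric. Only the values of `f` on `M`
matter. -/
structure IsRiemannianIsometry (n : ℕ) (M : Set E) (f : E → E) : Prop where
  mapsTo : MapsTo f M M
  smooth : SmoothOnSubmanifold n M f
  exists_inverse : ∃ f' : E → E, MapsTo f' M M ∧ InvOn f' f M M ∧ SmoothOnSubmanifold n M f'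
  isometry : ∀ φ U, IsLocalParam n M φ U →
    ∀ u ∈ U, inducedMetric (f ∘ φ) u = inducedMetric φ u

/-- `M` is intrinsically homogeneous: the isometry group of the Riemannian manifold `M` acts
transitively on `M`. The isometries need not extend to isometries of the ambient space. -/
def IsIntrinsicallyHomogeneous (n : ℕ) (M : Set E) : Prop :=
  ∀ x ∈ M, ∀ y ∈ M, ∃ f : E → E, IsRiemannianIsometry n M f ∧ f x = y

/-! ### Extrinsic geometry of submanifolds of the unit sphere -/

/-- The normal space at `x` of a submanifold `M` of the unit sphere, inside the tangent space
of the sphere: the vectors which are orthogonal to `x` and to the tangent space of `M`. -/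
def normalSpace (M : Set E) (x : E) : Submodule ℝ E :=
  (tangentSpace M x ⊔ Submodule.span ℝ {x})ᗮ

/-- `ν` is a smooth normal field of `M ⊆ S` near `x` (smoothly extended to a neighbourhood of `x`
in `E`) with the value `N` at `x`. -/
def IsNormalFieldAt (M : Set E) (x N : E) (ν : E → E) : Prop :=
  ContDiffAt ℝ ∞ ν x ∧ (∀ᶠ y in 𝓝[M] x, ν y ∈ normalSpace M y) ∧ ν x = N

open Classical in
/-- The shape operator `A_N X = -(D_X ν)ᵀ` of a submanifold `M` of the unit sphere at `x`, where
`ν` is any smooth normal field with `ν x = N`. The result does not depend on `ν`; the default `0`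
is used only if there is no such field, that is, if `N` is not normal to `M` at `x`. -/
def shapeOperator [FiniteDimensional ℝ E] (M : Set E) (x N : E) : tangentSpace M x →ₗ[ℝ] tangentSpace M x :=
  if h : ∃ ν : E → E, IsNormalFieldAt M x N ν then
    -((tangentSpace M x).orthogonalProjectionOnto.toLinearMap ∘ₗ
      (fderiv ℝ h.choose x).toLinearMap ∘ₗ (tangentSpace M x).subtype)
  else 0

/-- The common kernel `⋂ᵢ Ker A_{Nᵢ}` at `x`, a subspace of the tangent space of `M`. -/
def commonKernel [FiniteDimensional ℝ E] {r : ℕ} (M : Set E) (x : E) (N : Fin r → E) :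
    Submodule ℝ (tangentSpace M x) :=
  ⨅ i, LinearMap.ker (shapeOperator M x (N i))

/-- `N` is an orthonormal family of normal vectors of `M` at `x` in the unit sphere. -/
def IsOrthonormalNormal {r : ℕ} (M : Set E) (x : E) (N : Fin r → E) : Prop :=
  Orthonormal ℝ N ∧ ∀ i, N i ∈ normalSpace M x

/-! ### Clifford systems and the focal submanifold -/

/-- `{P₀, …, Pₘ}` is a symmetric Clifford system: the `P_α` are symmetric and
`P_α P_β + P_β P_α = 2 δ_{αβ} I`. -/
structure IsCliffordSystem {m : ℕ} (P : Fin (m + 1) → E →L[ℝ] E) : Prop where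
  symmetric : ∀ α, (P α).toLinearMap.IsSymmetric
  anticomm : ∀ α β, P α * P β + P β * P α = if α = β then 2 else 0

/-- The polynomial `F(x) = |x|⁴ - 2 ∑_α ⟨P_α x, x⟩²`. -/
def fkmPolynomial {m : ℕ} (P : Fin (m + 1) → E →L[ℝ] E) (x : E) : ℝ :=
  ‖x‖ ^ 4 - 2 * ∑ α, (inner ℝ (P α x) x) ^ 2

/-- The focal submanifold `M₁ = f⁻¹(1)`, where `f` is the restriction of `F` to the unit
sphere. -/
def focalM1 {m : ℕ} (P : Fin (m + 1) → E →L[ℝ] E) : Set E :=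
  {x | x ∈ Metric.sphere (0 : E) 1 ∧ fkmPolynomial P x = 1}

/-- The element `∑_α a_α P_α` of the span of the Clifford system. The inner product on the span is
the one in which the `P_α` are orthonormal, so that `a` may be any vector of `ℝ^{m+1}`, and
the Clifford sphere `Σ(P₀, …, Pₘ)` consists of the elements with `|a| = 1`. -/
def cliffordElement {m : ℕ} (P : Fin (m + 1) → E →L[ℝ] E)
    (a : EuclideanSpace ℝ (Fin (m + 1))) : E →L[ℝ] E :=
  ∑ α, a α • P α

/-- The set `Ω` of all `x ∈ M₁` such that `Q₀ Q₁ Q₂ Q₃ x = x` for some orthonormal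
`Q₀, …, Q₃` in the Clifford sphere. -/
def omegaSet {m : ℕ} (P : Fin (m + 1) → E →L[ℝ] E) : Set E :=
  {x | x ∈ focalM1 P ∧ ∃ a : Fin 4 → EuclideanSpace ℝ (Fin (m + 1)), Orthonormal ℝ a ∧
    cliffordElement P (a 0) (cliffordElement P (a 1)
      (cliffordElement P (a 2) (cliffordElement P (a 3) x))) = x}

end OTFKM

end

/-! The points of `M₁` are the unit vectors `x` with `⟨P_α x, x⟩ = 0`. At such a point the vectors
`x, P₀ x, …, P₃ x` are an orthonormal basis of the normal space in the ambient Euclidean space, and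
the shape operator in the direction `Q x`, for `Q` in the span of the Clifford system, is
`X ↦ -(Q X)ᵀ` (`IsCliffordSystem.shapeOperator_cliffordElement`). The operators `P_α` have trace
zero and their quadratic forms vanish on the normal vectors, so `M₁` is minimal, and the contracted
Gauss equation gives `ρ(X) = 2l - 6 - ∑_α |(P_α X)ᵀ|²` for unit vectors `X`
(`IsCliffordSystem.ricciCurvature_eq`). Hence the bound `2l - 6` is attained exactly on the unit
vectors of the common kernel of the shape operators, called `asymptoticSpace` below. By linearity
this kernel does not depend on the orthonormal normal frame (`IsCliffordSystem.map_commonKernel`).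

The Gauss equation is proved in coordinates for any immersion whose normal bundle has an orthonormal
frame of the form `B_a ∘ φ` with constant symmetric operators `B_a` (`IsFramedImmersion`); here
these are `I, P₀, …, P₃`. The second fundamental form is then `-⟨B_a ∂ᵢφ, ∂ⱼφ⟩`, so that no
derivative of the frame has to be computed separately.

The rest is Clifford algebra. If `P_i X` is normal, then `X = P_i P_i X` is a combination of the
three orthonormal vectors `P_i P_j x` with `j ≠ i`, so the kernel has dimension at most three.
Comparing these expansions for different `i` shows that a nonzero `X` in the kernel forces
`P_i P_j x = ± P_k P_l x` for some numbering of the indices, which means `x ∈ Ω`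
(`IsCliffordSystem.mem_omegaSet_of_mem_asymptoticSpace`). Conversely, if `Q₀ Q₁ Q₂ Q₃ x = x`, then
each `Q_i Q_j x` equals `± Q_k Q_l x`, and the three vectors `Q₀ Q_j x` span the
kernel. The product `P₀ P₁ P₂ P₃` is a symmetric involution which anticommutes with the `P_α`. Unit
vectors in its eigenspace for `1` lie in `Ω`, and `(x + y) / √2` with suitable `x`, `y` in the two
eigenspaces is a point of `M₁` outside `Ω`.

Finally, an isometry `f` of `M₁` maps `Ω` into itself: for a local parametrization `φ` the immersion
`f ∘ φ` induces the same metric, hence has the same Ricci tensor, and the Ricci formula holds for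
both of them. Since `Ω` is neither empty nor all of `M₁`, the isometries are not transitive. -/

noncomputable section

/-! ### Partial derivatives -/

namespace OTFKM

section Coordinates

variable {n : ℕ} {F : Type*} [NormedAddCommGroup F] [NormedSpace ℝ F]

theorem fderiv_eq_sum_pd (f : (Fin n → ℝ) → F) (u v : Fin n → ℝ) :
    fderiv ℝ f u v = ∑ i, v i • pd i f u := by
  conv_lhs => rw [pi_eq_sum_univ' v]
  simp only [map_sum, map_smul, pd]

theorem pd_congr {f g : (Fin n → ℝ) → F} {u : Fin n → ℝ} (i : Fin n) (h : f =ᶠ[𝓝 u] g) :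
    pd i f u = pd i g u := by
  simp only [pd, h.fderiv_eq]

theorem ContDiffOn.pd {f : (Fin n → ℝ) → F} {U : Set (Fin n → ℝ)} (hf : ContDiffOn ℝ ∞ f U)
    (hU : IsOpen U) (i : Fin n) : ContDiffOn ℝ ∞ (pd i f) U :=
  (hf.fderiv_of_isOpen hU (m := ∞) (by simp)).clm_apply contDiffOn_const

theorem ContDiffOn.differentiableAt_of_isOpen {f : (Fin n → ℝ) → F} {U : Set (Fin n → ℝ)}
    (hf : ContDiffOn ℝ ∞ f U) (hU : IsOpen U) {u : Fin n → ℝ} (hu : u ∈ U) :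
    DifferentiableAt ℝ f u :=
  (hf.contDiffAt (hU.mem_nhds hu)).differentiableAt (by simp)

theorem pd_comm {f : (Fin n → ℝ) → F} {U : Set (Fin n → ℝ)} (hf : ContDiffOn ℝ ∞ f U)
    (hU : IsOpen U) {u : Fin n → ℝ} (hu : u ∈ U) (i j : Fin n) :
    pd i (pd j f) u = pd j (pd i f) u := by
  have hd : DifferentiableAt ℝ (fderiv ℝ f) u :=
    ContDiffOn.differentiableAt_of_isOpen (hf.fderiv_of_isOpen hU (m := ∞) (by simp)) hU hu
  have key : ∀ i j : Fin n, OTFKM.pd i (OTFKM.pd j f) u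
      = fderiv ℝ (fderiv ℝ f) u (Pi.single i 1) (Pi.single j 1) := by
    intro i j
    have : OTFKM.pd j f = fun w => fderiv ℝ f w (Pi.single j 1) := rfl
    rw [OTFKM.pd, this, fderiv_clm_apply hd (differentiableAt_const _)]
    simp
  rw [key, key]
  exact ((hf.contDiffAt (hU.mem_nhds hu)).isSymmSndFDerivAt (by
    rw [minSmoothness_of_isRCLikeNormedField]
    exact WithTop.coe_le_coe.2 le_top)) _ _

theorem pd_inner {E : Type*} [NormedAddCommGroup E] [InnerProductSpace ℝ E]
    {f g : (Fin n → ℝ) → E} {u : Fin n → ℝ} (hf : DifferentiableAt ℝ f u)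
    (hg : DifferentiableAt ℝ g u) (i : Fin n) :
    pd i (fun w => (inner ℝ (f w) (g w) : ℝ)) u
      = inner ℝ (pd i f u) (g u) + inner ℝ (f u) (pd i g u) := by
  simp only [pd]
  rw [fderiv_inner_apply ℝ hf hg, add_comm]

theorem pd_smul {c : (Fin n → ℝ) → ℝ} {f : (Fin n → ℝ) → F} {u : Fin n → ℝ}
    (hc : DifferentiableAt ℝ c u) (hf : DifferentiableAt ℝ f u) (i : Fin n) :
    pd i (fun w => c w • f w) u = pd i c u • f u + c u • pd i f u := by
  simp only [pd]
  rw [fderiv_fun_smul hc hf]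
  simp [add_comm]

theorem pd_sum {ι : Type*} [Fintype ι] {f : ι → (Fin n → ℝ) → F} {u : Fin n → ℝ}
    (hf : ∀ a, DifferentiableAt ℝ (f a) u) (i : Fin n) :
    pd i (fun w => ∑ a, f a w) u = ∑ a, pd i (f a) u := by
  simp only [pd]
  rw [fderiv_fun_sum fun a _ => hf a]
  simp

theorem pd_clm {G : Type*} [NormedAddCommGroup G] [NormedSpace ℝ G] (L : F →L[ℝ] G)
    {f : (Fin n → ℝ) → F} {u : Fin n → ℝ} (hf : DifferentiableAt ℝ f u) (i : Fin n) :
    pd i (fun w => L (f w)) u = L (pd i f u) := by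
  simp only [pd]
  have := (L.hasFDerivAt.comp u hf.hasFDerivAt).fderiv
  exact congrArg (fun A => A (Pi.single i 1)) this

theorem pd_add {f g : (Fin n → ℝ) → F} {u : Fin n → ℝ} (hf : DifferentiableAt ℝ f u)
    (hg : DifferentiableAt ℝ g u) (i : Fin n) :
    pd i (fun w => f w + g w) u = pd i f u + pd i g u := by
  simp only [pd]
  rw [fderiv_fun_add hf hg]
  rfl

theorem christoffel_congr {g g' : (Fin n → ℝ) → Matrix (Fin n) (Fin n) ℝ} {u : Fin n → ℝ}
    (h : g =ᶠ[𝓝 u] g') (k i j : Fin n) : christoffel g k i j u = christoffel g' k i j u := by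
  have h' : ∀ i a b : Fin n, pd i (fun w => g w a b) u = pd i (fun w => g' w a b) u :=
    fun i a b => pd_congr i (h.mono fun w hw => by simp only [hw])
  simp only [christoffel, h', h.eq_of_nhds]

theorem ricciTensor_congr {g g' : (Fin n → ℝ) → Matrix (Fin n) (Fin n) ℝ} {u : Fin n → ℝ}
    (h : g =ᶠ[𝓝 u] g') (j k : Fin n) : ricciTensor g j k u = ricciTensor g' j k u := by
  have hΓ : ∀ a b c, christoffel g a b c =ᶠ[𝓝 u] christoffel g' a b c := fun a b c =>
    h.eventuallyEq_nhds.mono fun w hw => christoffel_congr hw a b c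
  simp only [ricciTensor, riemann]
  simp only [fun i a b c => pd_congr i (hΓ a b c), fun a b c => (hΓ a b c).eq_of_nhds]

theorem sum_sum_sum_comm {κ μ : Type*} [Fintype κ] [Fintype μ] (f : κ → κ → μ → ℝ) :
    ∑ i, ∑ j, ∑ a, f i j a = ∑ a, ∑ i, ∑ j, f i j a := by
  have h : ∀ i, ∑ j, ∑ a, f i j a = ∑ a, ∑ j, f i j a := fun i => Finset.sum_comm
  simp only [h]
  exact Finset.sum_comm

end Coordinates

/-! ### The Gauss equation in coordinates -/

theorem mem_orthogonal_span_range {E : Type*} [NormedAddCommGroup E] [InnerProductSpace ℝ E]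
    {κ : Type*} {f : κ → E} {X : E} :
    X ∈ (Submodule.span ℝ (Set.range f))ᗮ ↔ ∀ a, (inner ℝ (f a) X : ℝ) = 0 := by
  rw [Submodule.mem_orthogonal]
  refine ⟨fun h a => h _ (Submodule.subset_span ⟨a, rfl⟩), fun h y hy => ?_⟩
  induction hy using Submodule.span_induction with
  | mem y hy => obtain ⟨a, rfl⟩ := hy; exact h a
  | zero => simp
  | add y z _ _ hy hz => rw [inner_add_left, hy, hz, add_zero]
  | smul c y _ hy => rw [real_inner_smul_left, hy, mul_zero]

/-- A smooth immersion `φ : U → E` of an open subset of `ℝⁿ` together with an orthonormal frame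
of its normal bundle in `E` of the special form `B a ∘ φ`, where the `B a` are symmetric
operators on `E`. -/
structure IsFramedImmersion {E : Type*} [NormedAddCommGroup E] [InnerProductSpace ℝ E]
    {n : ℕ} {ι : Type*} [Fintype ι] (φ : (Fin n → ℝ) → E) (U : Set (Fin n → ℝ))
    (B : ι → E →L[ℝ] E) : Prop where
  isOpen : IsOpen U
  contDiffOn : ContDiffOn ℝ ∞ φ U
  immersion : ∀ u ∈ U, Function.Injective (fderiv ℝ φ u)
  symmetric : ∀ a, (B a).toLinearMap.IsSymmetric
  orthonormal : ∀ u ∈ U, Orthonormal ℝ fun a => B a (φ u)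
  normal : ∀ u ∈ U, ∀ a v, inner ℝ (B a (φ u)) (fderiv ℝ φ u v) = (0 : ℝ)
  card_add : Fintype.card ι + n = Module.finrank ℝ E

namespace IsFramedImmersion

variable {E : Type*} [NormedAddCommGroup E] [InnerProductSpace ℝ E]
  {n : ℕ} {ι : Type*} [Fintype ι] {φ : (Fin n → ℝ) → E} {U : Set (Fin n → ℝ)}
  {B : ι → E →L[ℝ] E}

theorem linearIndependent_pd (h : IsFramedImmersion φ U B) {u : Fin n → ℝ} (hu : u ∈ U) :
    LinearIndependent ℝ fun i => pd i φ u := by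
  rw [Fintype.linearIndependent_iff]
  intro c hc
  have h0 : fderiv ℝ φ u c = fderiv ℝ φ u 0 := by
    rw [fderiv_eq_sum_pd, hc, map_zero]
  intro i
  rw [h.immersion u hu h0]
  rfl

theorem isUnit_det (h : IsFramedImmersion φ U B) {u : Fin n → ℝ} (hu : u ∈ U) :
    IsUnit (inducedMetric φ u).det :=
  isUnit_iff_ne_zero.2
    (Matrix.det_gram_ne_zero_iff_linearIndependent.2 (h.linearIndependent_pd hu))

theorem inducedMetric_symm (φ : (Fin n → ℝ) → E) (u : Fin n → ℝ) (i j : Fin n) :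
    inducedMetric φ u i j = inducedMetric φ u j i := real_inner_comm _ _

theorem inv_inducedMetric_symm (φ : (Fin n → ℝ) → E) (u : Fin n → ℝ) (i j : Fin n) :
    (inducedMetric φ u)⁻¹ i j = (inducedMetric φ u)⁻¹ j i := by
  have h : (inducedMetric φ u).transpose = inducedMetric φ u := by
    ext a b
    exact inducedMetric_symm φ u b a
  conv_lhs => rw [← h, ← Matrix.transpose_nonsing_inv]
  rfl

theorem sum_inv_mul (h : IsFramedImmersion φ U B) {u : Fin n → ℝ} (hu : u ∈ U) (i j : Fin n) :
    ∑ l, (inducedMetric φ u)⁻¹ i l * inner ℝ (pd l φ u) (pd j φ u) = if i = j then 1 else 0 := by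
  have := congrFun (congrFun (Matrix.nonsing_inv_mul _ (h.isUnit_det hu)) i) j
  rw [Matrix.mul_apply, Matrix.one_apply] at this
  exact this

theorem contDiffOn_inner_pd (h : IsFramedImmersion φ U B) (i j : Fin n) :
    ContDiffOn ℝ ∞ (fun w => inducedMetric φ w i j) U :=
  (ContDiffOn.pd h.contDiffOn h.isOpen i).inner ℝ (ContDiffOn.pd h.contDiffOn h.isOpen j)

theorem contDiffOn_det {A : (Fin n → ℝ) → Matrix (Fin n) (Fin n) ℝ} {U : Set (Fin n → ℝ)}
    (hA : ∀ i j, ContDiffOn ℝ ∞ (fun w => A w i j) U) :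
    ContDiffOn ℝ ∞ (fun w => (A w).det) U := by
  simp only [Matrix.det_apply]
  refine ContDiffOn.sum fun σ _ => ContDiffOn.const_smul _ ?_
  exact contDiffOn_prod fun i _ => hA _ _

theorem contDiffOn_inv (h : IsFramedImmersion φ U B) (i j : Fin n) :
    ContDiffOn ℝ ∞ (fun w => (inducedMetric φ w)⁻¹ i j) U := by
  -- Cramer's rule
  simp only [Matrix.inv_def, Matrix.smul_apply, Ring.inverse_eq_inv', smul_eq_mul]
  refine ContDiffOn.mul ?_ ?_
  · exact (contDiffOn_det h.contDiffOn_inner_pd).inv fun w hw => (h.isUnit_det hw).ne_zero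
  · simp only [Matrix.adjugate_apply]
    refine contDiffOn_det fun a b => ?_
    simp only [Matrix.updateRow_apply]
    split_ifs
    · exact contDiffOn_const
    · exact h.contDiffOn_inner_pd a b

/-- Koszul's formula for the induced connection: `Γᵏᵢⱼ` is the `k`-th component of the tangential
part of `∂ᵢ∂ⱼφ`. -/
theorem christoffel_eq (h : IsFramedImmersion φ U B) {u : Fin n → ℝ} (hu : u ∈ U)
    (k i j : Fin n) :
    christoffel (inducedMetric φ) k i j u
      = ∑ l, (inducedMetric φ u)⁻¹ k l * inner ℝ (pd i (pd j φ) u) (pd l φ u) := by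
  have hd : ∀ a, DifferentiableAt ℝ (pd a φ) u := fun a =>
    ContDiffOn.differentiableAt_of_isOpen (ContDiffOn.pd h.contDiffOn h.isOpen a) h.isOpen hu
  have hg : ∀ i a b, pd i (fun w => inducedMetric φ w a b) u
      = inner ℝ (pd i (pd a φ) u) (pd b φ u) + inner ℝ (pd a φ u) (pd i (pd b φ) u) :=
    fun i a b => pd_inner (hd a) (hd b) i
  have hc := pd_comm h.contDiffOn h.isOpen hu
  rw [christoffel, Finset.mul_sum]
  refine Finset.sum_congr rfl fun l _ => ?_
  rw [hg, hg, hg, hc j i, hc l i, hc l j, real_inner_comm (pd j φ u) (pd i (pd l φ) u)]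
  ring

theorem contDiffOn_christoffel (h : IsFramedImmersion φ U B) (k i j : Fin n) :
    ContDiffOn ℝ ∞ (christoffel (inducedMetric φ) k i j) U := by
  refine ContDiffOn.congr ?_ fun u hu => h.christoffel_eq hu k i j
  refine ContDiffOn.sum fun l _ => (h.contDiffOn_inv k l).mul ?_
  exact (ContDiffOn.pd (ContDiffOn.pd h.contDiffOn h.isOpen j) h.isOpen i).inner ℝ
    (ContDiffOn.pd h.contDiffOn h.isOpen l)

theorem sum_mul_inner_pd (L M : E →L[ℝ] E) (φ : (Fin n → ℝ) → E) (u v : Fin n → ℝ) :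
    ∑ j, ∑ k, v j * v k * (inner ℝ (L (pd j φ u)) (M (pd k φ u)) : ℝ)
      = inner ℝ (L (fderiv ℝ φ u v)) (M (fderiv ℝ φ u v)) := by
  simp only [fderiv_eq_sum_pd φ u v, map_sum, map_smul, sum_inner, inner_sum,
    real_inner_smul_left, real_inner_smul_right]
  rw [Finset.sum_comm]
  exact Finset.sum_congr rfl fun _ _ => Finset.sum_congr rfl fun _ _ => by ring

/-- The tangent space is the orthogonal complement of the normal frame, by dimension. -/
theorem range_fderiv [FiniteDimensional ℝ E] (h : IsFramedImmersion φ U B) {u : Fin n → ℝ}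
    (hu : u ∈ U) : LinearMap.range (fderiv ℝ φ u).toLinearMap
      = (Submodule.span ℝ (Set.range fun a => B a (φ u)))ᗮ := by
  refine Submodule.eq_of_le_of_finrank_eq ?_ ?_
  · rintro _ ⟨v, rfl⟩
    exact mem_orthogonal_span_range.2 fun a => h.normal u hu a v
  · rw [LinearMap.finrank_range_of_inj (h.immersion u hu)]
    have h1 := Submodule.finrank_add_finrank_orthogonal
      (Submodule.span ℝ (Set.range fun a => B a (φ u)))
    rw [finrank_span_eq_card (h.orthonormal u hu).linearIndependent, ← h.card_add] at h1
    simp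
    omega

/-- The orthogonal decomposition of a vector into its tangential and its normal part. -/
theorem eq_tangential_add_normal [FiniteDimensional ℝ E] (h : IsFramedImmersion φ U B) {u : Fin n → ℝ} (hu : u ∈ U)
    (Z : E) :
    Z = ∑ k, (∑ l, (inducedMetric φ u)⁻¹ k l * inner ℝ Z (pd l φ u)) • pd k φ u
      + ∑ a, (inner ℝ Z (B a (φ u)) : ℝ) • B a (φ u) := by
  set T := ∑ k, (∑ l, (inducedMetric φ u)⁻¹ k l * inner ℝ Z (pd l φ u)) • pd k φ u with hT
  set S := ∑ a, (inner ℝ Z (B a (φ u)) : ℝ) • B a (φ u) with hS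
  have hTm : ∀ m, inner ℝ T (pd m φ u) = inner ℝ Z (pd m φ u) := by
    intro m
    rw [hT, sum_inner]
    simp only [real_inner_smul_left, Finset.sum_mul]
    rw [Finset.sum_comm]
    have : ∀ l, ∑ k, (inducedMetric φ u)⁻¹ k l * inner ℝ Z (pd l φ u)
        * inner ℝ (pd k φ u) (pd m φ u)
        = (inner ℝ Z (pd l φ u) : ℝ) * if l = m then 1 else 0 := by
      intro l
      rw [← h.sum_inv_mul hu l m, Finset.mul_sum]
      refine Finset.sum_congr rfl fun k _ => ?_
      rw [inv_inducedMetric_symm φ u k l]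
      ring
    simp [this]
  have hnorm : ∀ a m, inner ℝ (B a (φ u)) (pd m φ u) = (0 : ℝ) := fun a m => h.normal u hu a _
  have hSa : ∀ a, inner ℝ S (B a (φ u)) = inner ℝ Z (B a (φ u)) := by
    intro a
    rw [hS]
    exact (h.orthonormal u hu).inner_left_fintype _ a
  have hSm : ∀ m, inner ℝ S (pd m φ u) = (0 : ℝ) := by
    intro m
    rw [hS, sum_inner]
    simp [real_inner_smul_left, hnorm]
  have hTa : ∀ a, inner ℝ T (B a (φ u)) = (0 : ℝ) := by
    intro a
    rw [hT, sum_inner]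
    refine Finset.sum_eq_zero fun k _ => ?_
    rw [real_inner_smul_left, real_inner_comm, hnorm, mul_zero]
  have hD : Z - (T + S) ∈ LinearMap.range (fderiv ℝ φ u).toLinearMap := by
    rw [h.range_fderiv hu, mem_orthogonal_span_range]
    intro a
    rw [real_inner_comm, inner_sub_left, inner_add_left, hTa, hSa]
    ring
  obtain ⟨c, hc⟩ := hD
  have hc' : Z - (T + S) = ∑ m, c m • pd m φ u := by rw [← hc, ← fderiv_eq_sum_pd]; rfl
  have h0 : inner ℝ (Z - (T + S)) (Z - (T + S)) = (0 : ℝ) := by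
    conv_lhs => rw [hc', inner_sum]
    rw [← hc']
    refine Finset.sum_eq_zero fun m _ => ?_
    rw [real_inner_smul_right, inner_sub_left, inner_add_left, hTm, hSm]
    ring
  exact sub_eq_zero.1 (inner_self_eq_zero.1 h0)

/-- The normal components of `∂ᵢ∂ⱼφ`, from the derivative of `⟨B a φ, ∂ⱼφ⟩ = 0`. -/
theorem inner_pd_pd_normal (h : IsFramedImmersion φ U B) {u : Fin n → ℝ} (hu : u ∈ U)
    (i j : Fin n) (a : ι) :
    inner ℝ (pd i (pd j φ) u) (B a (φ u)) = -(inner ℝ (B a (pd i φ u)) (pd j φ u) : ℝ) := by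
  have hφ : DifferentiableAt ℝ φ u :=
    ContDiffOn.differentiableAt_of_isOpen h.contDiffOn h.isOpen hu
  have hφj : DifferentiableAt ℝ (pd j φ) u :=
    ContDiffOn.differentiableAt_of_isOpen (ContDiffOn.pd h.contDiffOn h.isOpen j) h.isOpen hu
  have h0 : pd i (fun w => (inner ℝ (B a (φ w)) (pd j φ w) : ℝ)) u = 0 := by
    have : (fun w => (inner ℝ (B a (φ w)) (pd j φ w) : ℝ)) =ᶠ[𝓝 u] fun _ => 0 :=
      Filter.eventually_of_mem (h.isOpen.mem_nhds hu) fun w hw => h.normal w hw a _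
    rw [pd_congr i this]
    simp [pd]
  have hBφ : DifferentiableAt ℝ (fun w => B a (φ w)) u := (B a).differentiableAt.comp u hφ
  rw [pd_inner hBφ hφj, pd_clm _ hφ] at h0
  rw [real_inner_comm]
  linarith

variable [FiniteDimensional ℝ E]

/-- The Gauss formula: the normal part of `∂ᵢ∂ⱼφ` is the second fundamental form. -/
theorem gauss_formula (h : IsFramedImmersion φ U B) {u : Fin n → ℝ} (hu : u ∈ U) (i j : Fin n) :
    pd i (pd j φ) u = ∑ k, christoffel (inducedMetric φ) k i j u • pd k φ u
      + ∑ a, (-(inner ℝ (B a (pd i φ u)) (pd j φ u) : ℝ)) • B a (φ u) := by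
  simp only [h.christoffel_eq hu, ← h.inner_pd_pd_normal hu]
  exact h.eq_tangential_add_normal hu _

theorem inner_pd_pd_tangent (h : IsFramedImmersion φ U B) {u : Fin n → ℝ} (hu : u ∈ U)
    (i j m : Fin n) :
    inner ℝ (pd i (pd j φ) u) (pd m φ u)
      = ∑ k, christoffel (inducedMetric φ) k i j u * inner ℝ (pd k φ u) (pd m φ u) := by
  rw [h.gauss_formula hu, inner_add_left, sum_inner, sum_inner]
  have : ∀ a, inner ℝ (B a (φ u)) (pd m φ u) = (0 : ℝ) := fun a => h.normal u hu a _
  simp [real_inner_smul_left, this]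

/-- The tangential components of the third derivatives, from the derivative of the Gauss formula. -/
theorem inner_pd_pd_pd (h : IsFramedImmersion φ U B) {u : Fin n → ℝ} (hu : u ∈ U)
    (i j k m : Fin n) :
    inner ℝ (pd i (pd j (pd k φ)) u) (pd m φ u)
      = ∑ l, (pd i (christoffel (inducedMetric φ) l j k) u
          + ∑ p, christoffel (inducedMetric φ) p j k u * christoffel (inducedMetric φ) l i p u)
            * inner ℝ (pd l φ u) (pd m φ u)
        - ∑ a, inner ℝ (B a (pd j φ u)) (pd k φ u) * inner ℝ (B a (pd i φ u)) (pd m φ u) := by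
  have hφ : DifferentiableAt ℝ φ u :=
    ContDiffOn.differentiableAt_of_isOpen h.contDiffOn h.isOpen hu
  have hd : ∀ a, DifferentiableAt ℝ (pd a φ) u := fun a =>
    ContDiffOn.differentiableAt_of_isOpen (ContDiffOn.pd h.contDiffOn h.isOpen a) h.isOpen hu
  have hΓ : ∀ a b c, DifferentiableAt ℝ (christoffel (inducedMetric φ) a b c) u := fun a b c =>
    ContDiffOn.differentiableAt_of_isOpen (h.contDiffOn_christoffel a b c) h.isOpen hu
  have hB : ∀ a, DifferentiableAt ℝ (fun w => B a (φ w)) u :=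
    fun a => (B a).differentiableAt.comp u hφ
  have hb : ∀ a, DifferentiableAt ℝ
      (fun w => -(inner ℝ (B a (pd j φ w)) (pd k φ w) : ℝ)) u :=
    fun a => (((B a).differentiableAt.comp u (hd j)).inner ℝ (hd k)).neg
  have hev : pd j (pd k φ) =ᶠ[𝓝 u] fun w =>
      (∑ l, christoffel (inducedMetric φ) l j k w • pd l φ w)
      + ∑ a, (-(inner ℝ (B a (pd j φ w)) (pd k φ w) : ℝ)) • B a (φ w) :=
    Filter.eventually_of_mem (h.isOpen.mem_nhds hu) fun w hw => h.gauss_formula hw j k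
  have hsplit : pd i (pd j (pd k φ)) u
      = (∑ l, (pd i (christoffel (inducedMetric φ) l j k) u • pd l φ u
          + christoffel (inducedMetric φ) l j k u • pd i (pd l φ) u))
        + ∑ a, (pd i (fun w => -(inner ℝ (B a (pd j φ w)) (pd k φ w) : ℝ)) u • B a (φ u)
          + (-(inner ℝ (B a (pd j φ u)) (pd k φ u) : ℝ)) • B a (pd i φ u)) := by
    rw [pd_congr i hev]
    refine (pd_add (DifferentiableAt.fun_sum fun l _ => (hΓ l j k).smul (hd l))
      (DifferentiableAt.fun_sum fun a _ => (hb a).smul (hB a)) i).trans ?_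
    congr 1
    · refine (pd_sum (fun l => (hΓ l j k).smul (hd l)) i).trans ?_
      exact Finset.sum_congr rfl fun l _ => pd_smul (hΓ l j k) (hd l) i
    · refine (pd_sum (fun a => (hb a).smul (hB a)) i).trans ?_
      refine Finset.sum_congr rfl fun a _ => ?_
      refine (pd_smul (hb a) (hB a) i).trans ?_
      rw [pd_clm _ hφ]
  have hn : ∀ a, inner ℝ (B a (φ u)) (pd m φ u) = (0 : ℝ) := fun a => h.normal u hu a _
  rw [hsplit, inner_add_left, sum_inner, sum_inner]
  simp only [inner_add_left, real_inner_smul_left, hn, mul_zero, zero_add, neg_mul,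
    h.inner_pd_pd_tangent hu, Finset.sum_neg_distrib, add_mul, Finset.sum_add_distrib]
  rw [← sub_eq_add_neg]
  congr 2
  simp only [Finset.mul_sum, Finset.sum_mul]
  rw [Finset.sum_comm]
  exact Finset.sum_congr rfl fun _ _ => Finset.sum_congr rfl fun _ _ => by ring

/-- The Gauss equation. It expresses that the third derivatives of `φ` commute. -/
theorem gauss_equation (h : IsFramedImmersion φ U B) {u : Fin n → ℝ} (hu : u ∈ U)
    (i j k m : Fin n) :
    ∑ l, riemann (inducedMetric φ) l k i j u * inner ℝ (pd l φ u) (pd m φ u)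
      = ∑ a, ((inner ℝ (B a (pd j φ u)) (pd k φ u) : ℝ) * inner ℝ (B a (pd i φ u)) (pd m φ u)
        - inner ℝ (B a (pd i φ u)) (pd k φ u) * inner ℝ (B a (pd j φ u)) (pd m φ u)) := by
  have hc := pd_comm (ContDiffOn.pd h.contDiffOn h.isOpen k) h.isOpen hu i j
  have h1 := h.inner_pd_pd_pd hu i j k m
  have h2 := h.inner_pd_pd_pd hu j i k m
  rw [hc, h2] at h1
  rw [Finset.sum_sub_distrib]
  have hR : ∀ l, riemann (inducedMetric φ) l k i j u
      = (pd i (christoffel (inducedMetric φ) l j k) u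
          + ∑ p, christoffel (inducedMetric φ) p j k u * christoffel (inducedMetric φ) l i p u)
        - (pd j (christoffel (inducedMetric φ) l i k) u
          + ∑ p, christoffel (inducedMetric φ) p i k u
            * christoffel (inducedMetric φ) l j p u) := by
    intro l
    simp only [riemann, Finset.sum_sub_distrib, mul_comm]
    ring
  simp only [hR, sub_mul, Finset.sum_sub_distrib]
  linarith

theorem riemann_eq (h : IsFramedImmersion φ U B) {u : Fin n → ℝ} (hu : u ∈ U)
    (l k i j : Fin n) :
    riemann (inducedMetric φ) l k i j u
      = ∑ m, (inducedMetric φ u)⁻¹ l m *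
        ∑ a, ((inner ℝ (B a (pd j φ u)) (pd k φ u) : ℝ) * inner ℝ (B a (pd i φ u)) (pd m φ u)
        - inner ℝ (B a (pd i φ u)) (pd k φ u) * inner ℝ (B a (pd j φ u)) (pd m φ u)) := by
  simp only [← h.gauss_equation hu, Finset.mul_sum]
  rw [Finset.sum_comm]
  have : ∀ p, ∑ m, (inducedMetric φ u)⁻¹ l m *
      (riemann (inducedMetric φ) p k i j u * inner ℝ (pd p φ u) (pd m φ u))
      = riemann (inducedMetric φ) p k i j u * if l = p then 1 else 0 := by
    intro p
    rw [← h.sum_inv_mul hu l p, Finset.mul_sum]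
    refine Finset.sum_congr rfl fun m _ => ?_
    rw [real_inner_comm (pd p φ u)]
    ring
  simp [this]

/-- The orthogonal decomposition of two vectors, read off from their inner product. -/
theorem inner_eq_tangential_add_normal (h : IsFramedImmersion φ U B) {u : Fin n → ℝ}
    (hu : u ∈ U) (Y Z : E) :
    (inner ℝ Y Z : ℝ) = (∑ k, ∑ l, (inducedMetric φ u)⁻¹ k l *
        (inner ℝ (pd k φ u) Y * inner ℝ Z (pd l φ u)))
      + ∑ a, inner ℝ Y (B a (φ u)) * inner ℝ Z (B a (φ u)) := by
  conv_lhs => rw [h.eq_tangential_add_normal hu Z]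
  simp only [inner_add_right, inner_sum, real_inner_smul_right, Finset.sum_mul]
  congr 1
  · refine Finset.sum_congr rfl fun k _ => Finset.sum_congr rfl fun l _ => ?_
    rw [real_inner_comm Y]
    ring
  · exact Finset.sum_congr rfl fun a _ => mul_comm _ _

/-- The trace of the tangential part of an operator. -/
theorem sum_inv_mul_inner (h : IsFramedImmersion φ U B) {u : Fin n → ℝ} (hu : u ∈ U)
    (L : E →L[ℝ] E) :
    ∑ i, ∑ m, (inducedMetric φ u)⁻¹ i m * inner ℝ (L (pd i φ u)) (pd m φ u)
      = LinearMap.trace ℝ E L.toLinearMap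
        - ∑ a, inner ℝ (L (B a (φ u))) (B a (φ u)) := by
  have e := stdOrthonormalBasis ℝ E
  rw [LinearMap.trace_eq_sum_inner _ e, eq_sub_iff_add_eq]
  have hs : ∀ s, inner ℝ (e s) (L.toLinearMap (e s))
      = (∑ i, ∑ m, (inducedMetric φ u)⁻¹ i m
          * (inner ℝ (L (pd i φ u)) (e s) * inner ℝ (e s) (pd m φ u)))
        + ∑ a, (inner ℝ (L (B a (φ u))) (e s) * inner ℝ (e s) (B a (φ u)) : ℝ) := by
    intro s
    have h1 : L.toLinearMap (e s) = L (e s) := rfl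
    rw [h1, real_inner_comm]
    conv_lhs => arg 2; rw [h.eq_tangential_add_normal hu (e s)]
    simp only [map_add, map_sum, map_smul, sum_inner, inner_add_left, real_inner_smul_left,
      Finset.sum_mul]
    congr 1
    · exact Finset.sum_congr rfl fun k _ => Finset.sum_congr rfl fun l _ => by ring
    · exact Finset.sum_congr rfl fun a _ => mul_comm _ _
  simp only [hs, Finset.sum_add_distrib]
  symm
  congr 1
  · rw [← sum_sum_sum_comm]
    refine Finset.sum_congr rfl fun i _ => Finset.sum_congr rfl fun m _ => ?_
    rw [← Finset.mul_sum, e.sum_inner_mul_inner]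
  · rw [Finset.sum_comm]
    refine Finset.sum_congr rfl fun a _ => ?_
    rw [e.sum_inner_mul_inner]

/-- The contracted Gauss equation. -/
theorem ricciTensor_eq (h : IsFramedImmersion φ U B) {u : Fin n → ℝ} (hu : u ∈ U)
    (j k : Fin n) :
    ricciTensor (inducedMetric φ) j k u
      = ∑ a, ((LinearMap.trace ℝ E (B a).toLinearMap
          - ∑ b, inner ℝ (B a (B b (φ u))) (B b (φ u)))
            * inner ℝ (B a (pd j φ u)) (pd k φ u)
          - (inner ℝ (B a (pd j φ u)) (B a (pd k φ u))
            - ∑ b, inner ℝ (B a (pd j φ u)) (B b (φ u))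
              * inner ℝ (B a (pd k φ u)) (B b (φ u)))) := by
  simp only [ricciTensor, h.riemann_eq hu, Finset.mul_sum (s := (Finset.univ : Finset ι))]
  rw [sum_sum_sum_comm]
  refine Finset.sum_congr rfl fun a _ => ?_
  rw [← h.sum_inv_mul_inner hu, real_inner_comm (B a (pd k φ u)),
    h.inner_eq_tangential_add_normal hu (B a (pd k φ u)) (B a (pd j φ u))]
  simp only [mul_comm (inner ℝ (B a (pd k φ u)) _ : ℝ), add_sub_cancel_right]
  simp only [Finset.sum_mul, ← Finset.sum_sub_distrib]
  refine Finset.sum_congr rfl fun i _ => Finset.sum_congr rfl fun m _ => ?_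
  have hs : inner ℝ (B a (pd i φ u)) (pd k φ u) = inner ℝ (pd i φ u) (B a (pd k φ u)) :=
    h.symmetric a _ _
  rw [hs]
  ring

theorem sum_mul_ricciTensor (h : IsFramedImmersion φ U B) {u : Fin n → ℝ} (hu : u ∈ U)
    (v : Fin n → ℝ) :
    ∑ j, ∑ k, v j * v k * ricciTensor (inducedMetric φ) j k u
      = ∑ a, ((LinearMap.trace ℝ E (B a).toLinearMap
          - ∑ b, inner ℝ (B a (B b (φ u))) (B b (φ u)))
            * inner ℝ (B a (fderiv ℝ φ u v)) (fderiv ℝ φ u v)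
          - (‖B a (fderiv ℝ φ u v)‖ ^ 2
            - ∑ b, (inner ℝ (B a (fderiv ℝ φ u v)) (B b (φ u))) ^ 2)) := by
  have hlin : ∀ (a : ι) (Y : E),
      (inner ℝ (B a (fderiv ℝ φ u v)) Y : ℝ) = ∑ j, v j * inner ℝ (B a (pd j φ u)) Y := by
    intro a Y
    simp only [fderiv_eq_sum_pd φ u v, map_sum, map_smul, sum_inner, real_inner_smul_left]
  simp only [h.ricciTensor_eq hu, Finset.mul_sum]
  rw [sum_sum_sum_comm]
  refine Finset.sum_congr rfl fun a _ => ?_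
  rw [← real_inner_self_eq_norm_sq, ← sum_mul_inner_pd (B a) (B a)]
  have h1 := sum_mul_inner_pd (B a) (ContinuousLinearMap.id ℝ E) φ u v
  simp only [ContinuousLinearMap.id_apply] at h1
  have h2 : ∑ b, (inner ℝ (B a (fderiv ℝ φ u v)) (B b (φ u)) : ℝ) ^ 2
      = ∑ j, ∑ k, v j * v k * ∑ b, inner ℝ (B a (pd j φ u)) (B b (φ u))
              * inner ℝ (B a (pd k φ u)) (B b (φ u)) := by
    simp only [hlin, sq, Finset.sum_mul_sum]
    simp only [Finset.mul_sum]
    rw [← sum_sum_sum_comm]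
    refine Finset.sum_congr rfl fun j _ => ?_
    exact Finset.sum_congr rfl fun _ _ => Finset.sum_congr rfl fun _ _ => by ring
  rw [← h1, h2, Finset.mul_sum, ← Finset.sum_sub_distrib, ← Finset.sum_sub_distrib]
  refine Finset.sum_congr rfl fun j _ => ?_
  rw [Finset.mul_sum, ← Finset.sum_sub_distrib, ← Finset.sum_sub_distrib]
  exact Finset.sum_congr rfl fun k _ => by ring

end IsFramedImmersion
end OTFKM

namespace OTFKM

/-! ### Clifford systems and the normal frame of the focal submanifold -/

variable {E : Type*} [NormedAddCommGroup E] [InnerProductSpace ℝ E]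
  {m : ℕ} {P : Fin (m + 1) → E →L[ℝ] E}

namespace IsCliffordSystem

theorem inner_left (h : IsCliffordSystem P) (α : Fin (m + 1)) (x y : E) :
    (inner ℝ (P α x) y : ℝ) = inner ℝ x (P α y) := h.symmetric α x y

theorem apply_apply_self (h : IsCliffordSystem P) (α : Fin (m + 1)) (x : E) :
    P α (P α x) = x := by
  have h1 := congrArg (fun A : E →L[ℝ] E => A x) (h.anticomm α α)
  simp only [if_true, add_apply, mul_apply_eq_comp] at h1
  have h2 : (2 : E →L[ℝ] E) x = (2 : ℝ) • x := by
    rw [← one_add_one_eq_two, add_apply, two_smul]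
    rfl
  rw [h2, ← two_smul ℝ] at h1
  exact smul_right_injective E two_ne_zero h1

theorem apply_apply_comm (h : IsCliffordSystem P) {α β : Fin (m + 1)} (hne : α ≠ β) (x : E) :
    P α (P β x) = -P β (P α x) := by
  have h1 := congrArg (fun A : E →L[ℝ] E => A x) (h.anticomm α β)
  simp only [if_neg hne, add_apply, mul_apply_eq_comp,
    zero_apply] at h1
  exact eq_neg_of_add_eq_zero_left h1

theorem inner_apply_apply_same (h : IsCliffordSystem P) (α : Fin (m + 1)) (x y : E) :
    (inner ℝ (P α x) (P α y) : ℝ) = inner ℝ x y := by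
  rw [h.inner_left, h.apply_apply_self]

theorem norm_apply (h : IsCliffordSystem P) (α : Fin (m + 1)) (x : E) : ‖P α x‖ = ‖x‖ := by
  rw [← sq_eq_sq₀ (norm_nonneg _) (norm_nonneg _), ← real_inner_self_eq_norm_sq,
    ← real_inner_self_eq_norm_sq, h.inner_apply_apply_same]

theorem inner_apply_apply_of_ne (h : IsCliffordSystem P) {α β : Fin (m + 1)} (hne : α ≠ β)
    (x : E) : (inner ℝ (P α x) (P β x) : ℝ) = 0 := by
  have h1 : (inner ℝ (P α x) (P β x) : ℝ) = -inner ℝ (P α x) (P β x) := by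
    conv_lhs => rw [h.inner_left, h.apply_apply_comm hne, inner_neg_right, ← h.inner_left,
      real_inner_comm]
  linarith

theorem mem_focalM1 : ∀ {x : E}, x ∈ focalM1 P ↔ ‖x‖ = 1 ∧ ∀ α, (inner ℝ (P α x) x : ℝ) = 0 := by
  intro x
  simp only [focalM1, fkmPolynomial, mem_ofPred_eq, mem_sphere_zero_iff_norm]
  refine and_congr_right fun hx => ?_
  rw [hx]
  constructor
  · intro h α
    have h0 : ∑ α, (inner ℝ (P α x) x : ℝ) ^ 2 = 0 := by linarith
    have := (Finset.sum_eq_zero_iff_of_nonneg fun α _ => sq_nonneg _).1 h0 α (Finset.mem_univ α)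
    exact pow_eq_zero_iff two_ne_zero |>.1 this
  · intro h
    simp [h]

/-- `P_α` is conjugate to `-P_α` by any other `P_β`. -/
theorem trace_eq_zero [FiniteDimensional ℝ E] (h : IsCliffordSystem P) {α β : Fin (m + 1)}
    (hne : α ≠ β) : LinearMap.trace ℝ E (P α).toLinearMap = 0 := by
  have h1 : (P α).toLinearMap = (P β).toLinearMap * ((P β).toLinearMap * (P α).toLinearMap) := by
    ext x
    exact (h.apply_apply_self β _).symm
  have h2 : (P β).toLinearMap * (P α).toLinearMap * (P β).toLinearMap = -(P α).toLinearMap := by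
    ext x
    change P β (P α (P β x)) = -P α x
    rw [h.apply_apply_comm hne, map_neg, h.apply_apply_self]
  have h3 : LinearMap.trace ℝ E (P α).toLinearMap = -LinearMap.trace ℝ E (P α).toLinearMap := by
    conv_lhs => rw [h1, LinearMap.trace_mul_comm, h2, map_neg]
  linarith

end IsCliffordSystem

/-- The operators `I, P₀, …, Pₘ`. At a point `x` of the focal submanifold they give the
orthonormal basis `x, P₀ x, …, Pₘ x` of the normal space in `E`. -/
def normalFrame (P : Fin (m + 1) → E →L[ℝ] E) : Option (Fin (m + 1)) → E →L[ℝ] E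
  | none => ContinuousLinearMap.id ℝ E
  | some α => P α

/-- The map `Z ↦ Z - ∑_β ⟨P_β x, Z⟩ P_β x`. For `x` in the focal submanifold and `Z ⟂ x` this is
the tangential part of `Z`. -/
def tangentialPart (P : Fin (m + 1) → E →L[ℝ] E) (x : E) : E →L[ℝ] E :=
  ContinuousLinearMap.id ℝ E - ∑ β, (innerSL ℝ (P β x)).smulRight (P β x)

theorem tangentialPart_apply (P : Fin (m + 1) → E →L[ℝ] E) (x Z : E) :
    tangentialPart P x Z = Z - ∑ β, (inner ℝ (P β x) Z : ℝ) • P β x := by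
  simp [tangentialPart]

namespace IsCliffordSystem

theorem normalFrame_symmetric (h : IsCliffordSystem P) (a : Option (Fin (m + 1))) :
    (normalFrame P a).toLinearMap.IsSymmetric := by
  cases a with
  | none => exact fun x y => rfl
  | some α => exact h.symmetric α

theorem orthonormal_apply (h : IsCliffordSystem P) {x : E} (hx : x ∈ focalM1 P) :
    Orthonormal ℝ fun α => P α x := by
  rw [mem_focalM1] at hx
  refine ⟨fun α => by rw [h.norm_apply, hx.1], fun α β hne => h.inner_apply_apply_of_ne hne x⟩

theorem orthonormal_normalFrame (h : IsCliffordSystem P) {x : E} (hx : x ∈ focalM1 P) :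
    Orthonormal ℝ fun a => normalFrame P a x := by
  have hx' := mem_focalM1.1 hx
  have ho := h.orthonormal_apply hx
  constructor
  · rintro (_ | α)
    · exact hx'.1
    · exact ho.1 α
  · rintro (_ | α) (_ | β) hne
    · exact absurd rfl hne
    · exact (real_inner_comm _ _).trans (hx'.2 β)
    · exact hx'.2 α
    · exact ho.2 fun hab => hne (congrArg some hab)

theorem norm_tangentialPart_sq (h : IsCliffordSystem P) {x : E} (hx : x ∈ focalM1 P) (Z : E) :
    ‖tangentialPart P x Z‖ ^ 2 = ‖Z‖ ^ 2 - ∑ β, (inner ℝ Z (P β x) : ℝ) ^ 2 := by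
  have hS : ∀ β, (inner ℝ (∑ β, (inner ℝ (P β x) Z : ℝ) • P β x) (P β x) : ℝ)
      = inner ℝ (P β x) Z := fun β => (h.orthonormal_apply hx).inner_left_fintype _ β
  have hSZ : (inner ℝ Z (∑ β, (inner ℝ (P β x) Z : ℝ) • P β x) : ℝ)
      = ∑ β, (inner ℝ Z (P β x) : ℝ) ^ 2 := by
    rw [inner_sum]
    refine Finset.sum_congr rfl fun β _ => ?_
    rw [real_inner_smul_right, real_inner_comm Z, sq]
  have hSS : (inner ℝ (∑ β, (inner ℝ (P β x) Z : ℝ) • P β x)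
      (∑ β, (inner ℝ (P β x) Z : ℝ) • P β x) : ℝ) = ∑ β, (inner ℝ Z (P β x) : ℝ) ^ 2 := by
    conv_lhs => rw [inner_sum]
    refine Finset.sum_congr rfl fun β _ => ?_
    rw [real_inner_smul_right, hS, real_inner_comm Z, sq]
  rw [tangentialPart_apply, norm_sub_sq_real, hSZ, ← real_inner_self_eq_norm_sq (∑ β, _), hSS]
  ring

/-- The quadratic form of `P_α` vanishes on the normal frame. As `P_α` has trace zero, the trace of
its tangential part vanishes, so that the focal submanifold is minimal. -/
theorem inner_apply_normalFrame (h : IsCliffordSystem P) {x : E} (hx : x ∈ focalM1 P)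
    (α : Fin (m + 1)) (a : Option (Fin (m + 1))) :
    (inner ℝ (P α (normalFrame P a x)) (normalFrame P a x) : ℝ) = 0 := by
  have hx' := mem_focalM1.1 hx
  rcases a with _ | β
  · exact hx'.2 α
  · change (inner ℝ (P α (P β x)) (P β x) : ℝ) = 0
    by_cases hab : α = β
    · rw [hab, h.apply_apply_self, real_inner_comm]
      exact hx'.2 β
    · rw [h.apply_apply_comm hab, inner_neg_left, h.inner_apply_apply_same, hx'.2, neg_zero]

/-- The velocities of curves in the focal submanifold are orthogonal to the normal frame. -/
theorem normal_of_hasDerivAt (h : IsCliffordSystem P) {γ : ℝ → E} {X : E}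
    (hγ : HasDerivAt γ X 0) (hM : ∀ᶠ t in 𝓝 0, γ t ∈ focalM1 P) (a : Option (Fin (m + 1))) :
    (inner ℝ (normalFrame P a (γ 0)) X : ℝ) = 0 := by
  have hc : (fun t => (inner ℝ (normalFrame P a (γ t)) (γ t) : ℝ)) =ᶠ[𝓝 0]
      fun _ => a.elim 1 fun _ => 0 := by
    filter_upwards [hM] with t ht
    have ht' := mem_focalM1.1 ht
    rcases a with _ | α
    · change (inner ℝ (γ t) (γ t) : ℝ) = 1
      rw [real_inner_self_eq_norm_sq, ht'.1, one_pow]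
    · exact ht'.2 α
  have hB : HasDerivAt (fun t => normalFrame P a (γ t)) (normalFrame P a X) 0 :=
    (normalFrame P a).hasFDerivAt.comp_hasDerivAt 0 hγ
  have h1 := (hB.inner ℝ hγ).unique ((hasDerivAt_const (0 : ℝ) _).congr_of_eventuallyEq hc)
  have h2 : (inner ℝ (normalFrame P a X) (γ 0) : ℝ) = inner ℝ X (normalFrame P a (γ 0)) :=
    h.normalFrame_symmetric a _ _
  rw [h2, real_inner_comm (normalFrame P a (γ 0)) X] at h1
  linarith [real_inner_comm (normalFrame P a (γ 0)) X]

theorem isFramedImmersion (h : IsCliffordSystem P) {n : ℕ} {φ : (Fin n → ℝ) → E}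
    {U : Set (Fin n → ℝ)} (hU : IsOpen U) (hφ : ContDiffOn ℝ ∞ φ U)
    (himm : ∀ u ∈ U, Function.Injective (fderiv ℝ φ u)) (hM : ∀ u ∈ U, φ u ∈ focalM1 P)
    (hd : m + 2 + n = Module.finrank ℝ E) : IsFramedImmersion φ U (normalFrame P) where
  isOpen := hU
  contDiffOn := hφ
  immersion := himm
  symmetric := h.normalFrame_symmetric
  orthonormal u hu := h.orthonormal_normalFrame (hM u hu)
  normal u hu a v := by
    have hc : ContinuousAt (fun t : ℝ => u + t • v) 0 := by fun_prop
    have hγ : HasDerivAt (fun t : ℝ => φ (u + t • v)) (fderiv ℝ φ u v) 0 := by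
      have hl : HasDerivAt (fun t : ℝ => u + t • v) v 0 := by
        simpa using ((hasDerivAt_id (0 : ℝ)).smul_const v).const_add u
      have hφu : HasFDerivAt φ (fderiv ℝ φ u) (u + (0 : ℝ) • v) := by
        simpa using (ContDiffOn.differentiableAt_of_isOpen hφ hU hu).hasFDerivAt
      exact hφu.comp_hasDerivAt 0 hl
    have := h.normal_of_hasDerivAt hγ ?_ a
    · simpa using this
    · filter_upwards [hc.eventually (hU.mem_nhds (by simpa using hu))] with t ht
      exact hM _ ht
  card_add := by simpa using hd

/-- The Gauss equation for the focal submanifold: its mean curvature vanishes, so that its Ricci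
curvature is that of the unit sphere minus the norms of the shape operators. -/
theorem sum_mul_ricciTensor [FiniteDimensional ℝ E] (h : IsCliffordSystem P) (hm : 1 ≤ m) {n : ℕ}
    {φ : (Fin n → ℝ) → E} {U : Set (Fin n → ℝ)} (hU : IsOpen U) (hφ : ContDiffOn ℝ ∞ φ U)
    (himm : ∀ u ∈ U, Function.Injective (fderiv ℝ φ u)) (hM : ∀ u ∈ U, φ u ∈ focalM1 P)
    (hd : m + 2 + n = Module.finrank ℝ E) {u : Fin n → ℝ} (hu : u ∈ U) (v : Fin n → ℝ) :
    ∑ j, ∑ k, v j * v k * ricciTensor (inducedMetric φ) j k u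
      = ((n : ℝ) - 1) * ‖fderiv ℝ φ u v‖ ^ 2
        - ∑ α, ‖tangentialPart P (φ u) (P α (fderiv ℝ φ u v))‖ ^ 2 := by
  have hF := h.isFramedImmersion hU hφ himm hM hd
  have hx := hM u hu
  set X := fderiv ℝ φ u v with hX
  have hn : ∀ a, (inner ℝ (normalFrame P a (φ u)) X : ℝ) = 0 := fun a => hF.normal u hu a v
  rw [hF.sum_mul_ricciTensor hu, Fintype.sum_option,
    sub_eq_add_neg _ (∑ α, ‖tangentialPart P (φ u) (P α X)‖ ^ 2),
    ← Finset.sum_neg_distrib, ← hX]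
  congr 1
  · have h1 : ∀ b, (inner ℝ (normalFrame P none (normalFrame P b (φ u)))
        (normalFrame P b (φ u)) : ℝ) = 1 := by
      intro b
      have := (h.orthonormal_normalFrame hx).1 b
      change (inner ℝ (normalFrame P b (φ u)) (normalFrame P b (φ u)) : ℝ) = 1
      rw [real_inner_self_eq_norm_sq, this, one_pow]
    have h2 : ∀ b, (inner ℝ (normalFrame P none X) (normalFrame P b (φ u)) : ℝ) = 0 := by
      intro b
      rw [real_inner_comm]
      exact hn b
    have h3 : LinearMap.trace ℝ E (normalFrame P none).toLinearMap = Module.finrank ℝ E :=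
      LinearMap.trace_id ℝ E
    have h4 : normalFrame P none X = X := rfl
    simp only [h1, h2]
    rw [h3, h4, ← hd, real_inner_self_eq_norm_sq]
    simp
    ring
  · refine Finset.sum_congr rfl fun α _ => ?_
    obtain ⟨β, hβ⟩ : ∃ β, α ≠ β := by
      have : Nontrivial (Fin (m + 1)) := Fin.nontrivial_iff_two_le.2 (by omega)
      obtain ⟨β, hβ⟩ := exists_ne α
      exact ⟨β, hβ.symm⟩
    have h3 : LinearMap.trace ℝ E (normalFrame P (some α)).toLinearMap = 0 :=
      h.trace_eq_zero hβ
    have h5 : ∀ b, (inner ℝ (normalFrame P (some α) (normalFrame P b (φ u)))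
        (normalFrame P b (φ u)) : ℝ) = 0 := h.inner_apply_normalFrame hx α
    have h6 : (inner ℝ (normalFrame P (some α) X) (normalFrame P none (φ u)) : ℝ) = 0 := by
      change (inner ℝ (P α X) (φ u) : ℝ) = 0
      rw [h.inner_left, real_inner_comm]
      exact hn (some α)
    rw [h3, Fintype.sum_option (f := fun b => (inner ℝ _ (normalFrame P b (φ u)) : ℝ) ^ 2), h6,
      h.norm_tangentialPart_sq hx]
    simp only [h5]
    simp [normalFrame]

end IsCliffordSystem
end OTFKM

namespace OTFKM

/-! ### The focal submanifold, its normal space and its shape operators -/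

variable {E : Type*} [NormedAddCommGroup E] [InnerProductSpace ℝ E]
  {m : ℕ} {P : Fin (m + 1) → E →L[ℝ] E}

theorem IsLocalParam.apply_mem {n : ℕ} {M : Set E} {φ : (Fin n → ℝ) → E} {U : Set (Fin n → ℝ)}
    (hφ : IsLocalParam n M φ U) {u : Fin n → ℝ} (hu : u ∈ U) : φ u ∈ M := by
  obtain ⟨W, -, hW⟩ := hφ.isOpen_image
  exact (hW.subset ⟨u, hu, rfl⟩).1

namespace IsCliffordSystem

theorem mem_focalM1_iff_normalFrame {x : E} : x ∈ focalM1 P ↔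
    (fun a => (inner ℝ (normalFrame P a x) x : ℝ)) = fun a => a.elim 1 fun _ => 0 := by
  rw [mem_focalM1, funext_iff, Option.forall]
  refine and_congr ?_ Iff.rfl
  change ‖x‖ = 1 ↔ (inner ℝ x x : ℝ) = 1
  rw [real_inner_self_eq_norm_sq, pow_eq_one_iff_of_nonneg (norm_nonneg x) two_ne_zero]

variable [FiniteDimensional ℝ E]

/-- The level set `{y | ⟨y, y⟩ = 1, ⟨P_α y, y⟩ = 0}` is regular because the gradients of the
defining functions are twice the members of the normal frame. -/
theorem isSmoothSubmanifold_focalM1 (h : IsCliffordSystem P) {n : ℕ}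
    (hd : m + 2 + n = Module.finrank ℝ E) : IsSmoothSubmanifold n (focalM1 P) := by
  intro x hx
  set W : Submodule ℝ E := (Submodule.span ℝ (Set.range fun a => normalFrame P a x))ᗮ with hW
  have hWn : Module.finrank ℝ W = n := by
    have h1 := Submodule.finrank_add_finrank_orthogonal
      (Submodule.span ℝ (Set.range fun a => normalFrame P a x))
    rw [finrank_span_eq_card (h.orthonormal_normalFrame hx).linearIndependent, ← hd] at h1
    simp at h1
    omega
  have e : W ≃L[ℝ] (Fin n → ℝ) := ContinuousLinearEquiv.ofFinrankEq (by simp [hWn])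
  let L : E →L[ℝ] (Fin n → ℝ) := e.toContinuousLinearMap ∘L W.orthogonalProjectionOnto
  let Φ : E → (Option (Fin (m + 1)) → ℝ) × (Fin n → ℝ) :=
    fun y => (fun a => inner ℝ (normalFrame P a y) y, L y)
  let c : Option (Fin (m + 1)) → ℝ := fun a => a.elim 1 fun _ => 0
  have hΦ : ContDiff ℝ ∞ Φ :=
    (contDiff_pi.2 fun a => (normalFrame P a).contDiff.inner ℝ contDiff_id).prodMk L.contDiff
  -- near `x` the map `Φ` is a chart of `E` which turns the focal submanifold into `{c} × ℝⁿ`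
  have hΦ' : ∀ v, fderiv ℝ Φ x v = (fun a => 2 * inner ℝ (normalFrame P a x) v, L v) := by
    intro v
    have h1 : HasFDerivAt Φ ((ContinuousLinearMap.pi fun a =>
        (2 : ℝ) • innerSL ℝ (normalFrame P a x)).prod L) x := by
      refine HasFDerivAt.prodMk (hasFDerivAt_pi.2 fun a => ?_) L.hasFDerivAt
      refine ((normalFrame P a).hasFDerivAt.inner ℝ (hasFDerivAt_id x)).congr_fderiv ?_
      ext w
      have hs : (inner ℝ (normalFrame P a w) x : ℝ) = inner ℝ w (normalFrame P a x) :=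
        h.normalFrame_symmetric a w x
      simp [fderivInnerCLM_apply, hs, real_inner_comm w]
      ring
    rw [h1.fderiv]
    rfl
  have hinj : Function.Injective (fderiv ℝ Φ x) := by
    rw [injective_iff_map_eq_zero]
    intro v hv
    rw [hΦ', Prod.mk_eq_zero] at hv
    have hvW : v ∈ W := by
      rw [hW, mem_orthogonal_span_range]
      intro a
      simpa using congrFun hv.1 a
    have h2 : W.orthogonalProjectionOnto v = 0 := by simpa [L] using hv.2
    have h3 := W.orthogonalProjectionOnto_mem_subspace_eq_self ⟨v, hvW⟩
    rw [h2] at h3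
    exact (congrArg Subtype.val h3).symm
  have hfin : Module.finrank ℝ E
      = Module.finrank ℝ ((Option (Fin (m + 1)) → ℝ) × (Fin n → ℝ)) := by
    rw [← hd, Module.finrank_prod, Module.finrank_fintype_fun_eq_card,
      Module.finrank_fintype_fun_eq_card]
    simp
  let D : E ≃L[ℝ] (Option (Fin (m + 1)) → ℝ) × (Fin n → ℝ) :=
    (LinearEquiv.ofInjectiveOfFinrankEq (fderiv ℝ Φ x).toLinearMap hinj
      hfin).toContinuousLinearEquiv
  have hD : (D : E →L[ℝ] _) = fderiv ℝ Φ x := by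
    ext v <;> rfl
  have hx' : HasFDerivAt Φ (D : E →L[ℝ] _) x := by
    rw [hD]
    exact (hΦ.differentiable (by simp) x).hasFDerivAt
  let G₀ := hΦ.contDiffAt.toOpenPartialHomeomorph Φ hx' (by simp)
  -- restrict to the points where `dΦ` is invertible, so that the inverse is smooth everywhere
  let R : Set E := {y | fderiv ℝ Φ y ∈ range
    ((↑) : (E ≃L[ℝ] (Option (Fin (m + 1)) → ℝ) × (Fin n → ℝ)) → E →L[ℝ] _)}
  have hR : IsOpen R :=
    ContinuousLinearEquiv.isOpen.preimage (hΦ.continuous_fderiv (by simp))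
  let G := G₀.restrOpen R hR
  have hG : ∀ y, G y = Φ y := fun y => rfl
  have hxG : x ∈ G.source :=
    ⟨hΦ.contDiffAt.mem_toOpenPartialHomeomorph_source hx' (by simp), ⟨D, hD⟩⟩
  let φ : (Fin n → ℝ) → E := fun u => G.symm (c, u)
  let U : Set (Fin n → ℝ) := {u | (c, u) ∈ G.target}
  have hU : IsOpen U := G.open_target.preimage (by fun_prop)
  have hΦφ : ∀ u ∈ U, Φ (φ u) = (c, u) := fun u hu => G.right_inv hu
  have hLφ : ∀ u ∈ U, L (φ u) = u := fun u hu => congrArg Prod.snd (hΦφ u hu)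
  have hMφ : ∀ u ∈ U, φ u ∈ focalM1 P := fun u hu =>
    mem_focalM1_iff_normalFrame.2 (congrArg Prod.fst (hΦφ u hu))
  have hφ : ContDiffOn ℝ ∞ φ U := by
    intro u hu
    obtain ⟨A, hA⟩ := (G.map_target hu).2
    have h1 : ContDiffAt ℝ ∞ G.symm (c, u) := by
      refine G.contDiffAt_symm (f₀' := A) hu ?_ hΦ.contDiffAt
      rw [hA]
      exact (hΦ.differentiable (by simp) _).hasFDerivAt
    exact (h1.comp u (contDiffAt_const.prodMk contDiffAt_id)).contDiffWithinAt
  have hback : ∀ y ∈ focalM1 P, y ∈ G.source → L y ∈ U ∧ φ (L y) = y := by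
    intro y hyM hyG
    have h1 : Φ y = (c, L y) := Prod.ext (mem_focalM1_iff_normalFrame.1 hyM) rfl
    have h2 := G.map_source hyG
    have h3 := G.left_inv hyG
    rw [hG, h1] at h2 h3
    exact ⟨h2, h3⟩
  refine ⟨φ, U, ⟨hU, hφ, ?_, ?_, G.source, G.open_source, ?_⟩, ?_⟩
  · intro u hu v w hvw
    have h1 : HasFDerivAt (L ∘ φ) (L ∘L fderiv ℝ φ u) u :=
      L.hasFDerivAt.comp u (ContDiffOn.differentiableAt_of_isOpen hφ hU hu).hasFDerivAt
    have h2 : HasFDerivAt (L ∘ φ) (ContinuousLinearMap.id ℝ _) u :=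
      (hasFDerivAt_id u).congr_of_eventuallyEq
        (Filter.eventually_of_mem (hU.mem_nhds hu) hLφ)
    have h3 := h1.unique h2
    have h4 : ∀ v, L (fderiv ℝ φ u v) = v := fun v => congrArg (fun A => A v) h3
    rw [← h4 v, hvw, h4]
  · -- `L` is a continuous left inverse of `φ`
    refine IsEmbedding.of_comp (g := L) hφ.continuousOn.domRestrict L.continuous ?_
    have : L ∘ U.domRestrict φ = Subtype.val := funext fun u => hLφ u u.2
    rw [this]
    exact IsEmbedding.subtypeVal
  · ext y
    constructor
    · rintro ⟨u, hu, rfl⟩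
      exact ⟨hMφ u hu, G.map_target hu⟩
    · rintro ⟨hyM, hyG⟩
      exact ⟨L y, hback y hyM hyG⟩
  · exact ⟨L x, hback x hx hxG⟩

theorem exists_isLocalParam (h : IsCliffordSystem P) {n : ℕ}
    (hd : m + 2 + n = Module.finrank ℝ E) {x : E} (hx : x ∈ focalM1 P) {X : E}
    (hX : ∀ a, (inner ℝ (normalFrame P a x) X : ℝ) = 0) :
    ∃ φ U, ∃ u ∈ U, ∃ v, IsLocalParam n (focalM1 P) φ U ∧ φ u = x ∧ fderiv ℝ φ u v = X := by
  obtain ⟨φ, U, hφ, u, hu, rfl⟩ := h.isSmoothSubmanifold_focalM1 hd x hx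
  have hF := h.isFramedImmersion hφ.isOpen hφ.contDiffOn hφ.immersion (fun _ => hφ.apply_mem) hd
  have hXr : X ∈ LinearMap.range (fderiv ℝ φ u).toLinearMap := by
    rw [hF.range_fderiv hu]
    exact mem_orthogonal_span_range.2 hX
  obtain ⟨v, hv⟩ := hXr
  exact ⟨φ, U, u, hu, v, hφ, rfl, hv⟩

theorem exists_dim (h : IsCliffordSystem P) {x : E} (hx : x ∈ focalM1 P) :
    ∃ n, m + 2 + n = Module.finrank ℝ E := by
  have := (h.orthonormal_normalFrame hx).linearIndependent.fintype_card_le_finrank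
  simp only [Fintype.card_option, Fintype.card_fin] at this
  exact ⟨Module.finrank ℝ E - (m + 2), by omega⟩

theorem mem_tangentSpace (h : IsCliffordSystem P) {x : E} (hx : x ∈ focalM1 P) {X : E} :
    X ∈ tangentSpace (focalM1 P) x ↔ ∀ a, (inner ℝ (normalFrame P a x) X : ℝ) = 0 := by
  constructor
  · intro hX a
    induction hX using Submodule.span_induction with
    | mem X hX =>
      obtain ⟨γ, hγ, hM, rfl, rfl⟩ := hX
      exact h.normal_of_hasDerivAt (hγ.differentiableAt (by simp)).hasDerivAt hM a
    | zero => simp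
    | add y z _ _ hy hz => rw [inner_add_right, hy, hz, add_zero]
    | smul c y _ hy => rw [real_inner_smul_right, hy, mul_zero]
  · intro hX
    obtain ⟨n, hd⟩ := h.exists_dim hx
    obtain ⟨φ, U, u, hu, v, hφ, rfl, rfl⟩ := h.exists_isLocalParam hd hx hX
    refine Submodule.subset_span ⟨fun t => φ (u + t • v), ?_, ?_, by simp, ?_⟩
    · have h1 : ContDiffAt ℝ ∞ φ (u + (0 : ℝ) • v) := by
        simpa using hφ.contDiffOn.contDiffAt (hφ.isOpen.mem_nhds hu)
      exact h1.comp 0 (by fun_prop)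
    · have hc : ContinuousAt (fun t : ℝ => u + t • v) 0 := by fun_prop
      filter_upwards [hc.eventually (hφ.isOpen.mem_nhds (by simpa using hu))] with t ht
      exact hφ.apply_mem ht
    · have hl : HasDerivAt (fun t : ℝ => u + t • v) v 0 := by
        simpa using ((hasDerivAt_id (0 : ℝ)).smul_const v).const_add u
      have hφu : HasFDerivAt φ (fderiv ℝ φ u) (u + (0 : ℝ) • v) := by
        simpa using
          (ContDiffOn.differentiableAt_of_isOpen hφ.contDiffOn hφ.isOpen hu).hasFDerivAt
      exact (hφu.comp_hasDerivAt 0 hl).deriv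

theorem mem_tangentSpace' (h : IsCliffordSystem P) {x : E} (hx : x ∈ focalM1 P) {X : E} :
    X ∈ tangentSpace (focalM1 P) x ↔
      (inner ℝ x X : ℝ) = 0 ∧ ∀ α, (inner ℝ (P α x) X : ℝ) = 0 := by
  rw [h.mem_tangentSpace hx, Option.forall]
  rfl

/-- The intrinsic Ricci curvature of the focal submanifold. -/
theorem ricciCurvature_eq (h : IsCliffordSystem P) (hm : 1 ≤ m) {n : ℕ}
    (hd : m + 2 + n = Module.finrank ℝ E) {x : E} (hx : x ∈ focalM1 P) {X : E}
    (hX : X ∈ tangentSpace (focalM1 P) x) :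
    ricciCurvature n (focalM1 P) x X
      = ((n : ℝ) - 1) * ‖X‖ ^ 2 - ∑ α, ‖tangentialPart P x (P α X)‖ ^ 2 := by
  have hex : ∃ q : ((Fin n → ℝ) → E) × Set (Fin n → ℝ) × (Fin n → ℝ) × (Fin n → ℝ),
      IsLocalParam n (focalM1 P) q.1 q.2.1 ∧ q.2.2.1 ∈ q.2.1 ∧ q.1 q.2.2.1 = x ∧
        fderiv ℝ q.1 q.2.2.1 q.2.2.2 = X := by
    obtain ⟨φ, U, u, hu, v, hφ, h1, h2⟩ :=
      h.exists_isLocalParam hd hx ((h.mem_tangentSpace hx).1 hX)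
    exact ⟨(φ, U, u, v), hφ, hu, h1, h2⟩
  rw [ricciCurvature, dif_pos hex]
  obtain ⟨hφ, hu, h1, h2⟩ := hex.choose_spec
  rw [h.sum_mul_ricciTensor hm hφ.isOpen hφ.contDiffOn hφ.immersion (fun _ => hφ.apply_mem) hd
    hu, h1, h2]

theorem tangentialPart_mem_tangentSpace (h : IsCliffordSystem P) {x : E} (hx : x ∈ focalM1 P)
    {Z : E} (hZ : (inner ℝ x Z : ℝ) = 0) :
    tangentialPart P x Z ∈ tangentSpace (focalM1 P) x := by
  have h0 := mem_focalM1.1 hx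
  rw [h.mem_tangentSpace' hx, tangentialPart_apply]
  constructor
  · rw [inner_sub_right, hZ, inner_sum, zero_sub, neg_eq_zero]
    refine Finset.sum_eq_zero fun α _ => ?_
    rw [real_inner_smul_right, real_inner_comm (P α x) x, h0.2, mul_zero]
  · intro β
    rw [inner_sub_right, (h.orthonormal_apply hx).inner_right_fintype, sub_self]

theorem mem_normalSpace (h : IsCliffordSystem P) {x : E} (hx : x ∈ focalM1 P) {N : E} :
    N ∈ normalSpace (focalM1 P) x ↔ N = ∑ α, (inner ℝ (P α x) N : ℝ) • P α x := by
  have h0 := mem_focalM1.1 hx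
  rw [normalSpace, ← Submodule.inf_orthogonal, Submodule.mem_inf, Submodule.mem_orthogonal,
    Submodule.mem_orthogonal_singleton_iff_inner_right]
  constructor
  · rintro ⟨h1, h2⟩
    have hβ : ∀ β, (inner ℝ (P β x) (N - ∑ α, (inner ℝ (P α x) N : ℝ) • P α x) : ℝ) = 0 := by
      intro β
      rw [inner_sub_right, (h.orthonormal_apply hx).inner_right_fintype, sub_self]
    have hT := h.tangentialPart_mem_tangentSpace hx h2
    have h3 := h1 _ hT
    rw [tangentialPart_apply] at h3
    have h4 : (inner ℝ (N - ∑ α, (inner ℝ (P α x) N : ℝ) • P α x)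
        (N - ∑ α, (inner ℝ (P α x) N : ℝ) • P α x) : ℝ) = 0 := by
      rw [inner_sub_right, h3, inner_sum, zero_sub, neg_eq_zero]
      refine Finset.sum_eq_zero fun α _ => ?_
      rw [real_inner_smul_right, real_inner_comm (P α x) (_ - _), hβ, mul_zero]
    exact sub_eq_zero.1 (inner_self_eq_zero.1 h4)
  · intro hN
    rw [hN]
    constructor
    · intro Y hY
      have hY' := (h.mem_tangentSpace' hx).1 hY
      rw [inner_sum]
      refine Finset.sum_eq_zero fun α _ => ?_
      rw [real_inner_smul_right, real_inner_comm (P α x) Y, hY'.2, mul_zero]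
    · rw [inner_sum]
      refine Finset.sum_eq_zero fun α _ => ?_
      rw [real_inner_smul_right, real_inner_comm (P α x) x, h0.2, mul_zero]

end IsCliffordSystem

theorem cliffordElement_apply (P : Fin (m + 1) → E →L[ℝ] E)
    (a : EuclideanSpace ℝ (Fin (m + 1))) (x : E) :
    cliffordElement P a x = ∑ α, a α • P α x := by
  simp [cliffordElement]

namespace IsCliffordSystem

theorem inner_apply_cliffordElement (h : IsCliffordSystem P) {x : E} (hx : x ∈ focalM1 P)
    (a : EuclideanSpace ℝ (Fin (m + 1))) (α : Fin (m + 1)) :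
    (inner ℝ (P α x) (cliffordElement P a x) : ℝ) = a α := by
  rw [cliffordElement_apply]
  exact (h.orthonormal_apply hx).inner_right_fintype _ α

variable [FiniteDimensional ℝ E]

theorem cliffordElement_mem_normalSpace (h : IsCliffordSystem P) {x : E} (hx : x ∈ focalM1 P)
    (a : EuclideanSpace ℝ (Fin (m + 1))) :
    cliffordElement P a x ∈ normalSpace (focalM1 P) x := by
  rw [h.mem_normalSpace hx]
  simp only [h.inner_apply_cliffordElement hx]
  exact cliffordElement_apply P a x

/-- The shape operator in the direction `Q x`, where `Q` is in the span of the Clifford system, is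
`X ↦ -(Q X)ᵀ`: the field `y ↦ Q y` is normal, and any other normal field with the same value at
`x` has the same tangential derivative. -/
theorem shapeOperator_cliffordElement (h : IsCliffordSystem P) {x : E} (hx : x ∈ focalM1 P)
    (a : EuclideanSpace ℝ (Fin (m + 1))) (X : tangentSpace (focalM1 P) x) :
    (shapeOperator (focalM1 P) x (cliffordElement P a x) X : E)
      = -tangentialPart P x (cliffordElement P a X) := by
  have hex : ∃ ν : E → E, IsNormalFieldAt (focalM1 P) x (cliffordElement P a x) ν :=
    ⟨cliffordElement P a, (cliffordElement P a).contDiff.contDiffAt,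
      Filter.eventually_of_mem self_mem_nhdsWithin fun y hy =>
        h.cliffordElement_mem_normalSpace hy a, rfl⟩
  rw [shapeOperator, dif_pos hex]
  obtain ⟨hν, hνN, hνx⟩ := hex.choose_spec
  set ν := hex.choose with hνdef
  have hνd : HasFDerivAt ν (fderiv ℝ ν x) x := (hν.differentiableAt (by simp)).hasFDerivAt
  set S := Submodule.span ℝ (Set.range fun α => P α x) with hS
  have hPS : ∀ α, P α x ∈ S := fun α => Submodule.subset_span ⟨α, rfl⟩
  -- differentiate `ν = ∑ ⟨P_α y, ν⟩ P_α y` along curves in the focal submanifold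
  have key : ∀ Y ∈ tangentSpace (focalM1 P) x,
      fderiv ℝ ν x Y - cliffordElement P a Y ∈ S := by
    intro Y hY
    induction hY using Submodule.span_induction with
    | mem Y hY =>
      obtain ⟨γ, hγ, hM, hγ0, rfl⟩ := hY
      have hγd : HasDerivAt γ (deriv γ 0) 0 := (hγ.differentiableAt (by simp)).hasDerivAt
      have hνγ : HasDerivAt (fun t => ν (γ t)) (fderiv ℝ ν x (deriv γ 0)) 0 := by
        rw [← hγ0] at hνd
        have := hνd.comp_hasDerivAt 0 hγd
        rwa [hγ0] at this
      have htend : Filter.Tendsto γ (𝓝 0) (𝓝[focalM1 P] x) := by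
        refine tendsto_nhdsWithin_iff.2 ⟨?_, hM⟩
        rw [← hγ0]
        exact hγd.continuousAt
      have hev : (fun t => ν (γ t)) =ᶠ[𝓝 0]
          fun t => ∑ α, (inner ℝ (P α (γ t)) (ν (γ t)) : ℝ) • P α (γ t) := by
        filter_upwards [hM, htend.eventually hνN] with t ht1 ht2
        exact (h.mem_normalSpace ht1).1 ht2
      have hPγ : ∀ α, HasDerivAt (fun t => P α (γ t)) (P α (deriv γ 0)) 0 :=
        fun α => (P α).hasFDerivAt.comp_hasDerivAt 0 hγd
      have h1 := hνγ.unique ((HasDerivAt.fun_sum fun α _ =>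
        (((hPγ α).inner ℝ hνγ).smul (hPγ α))).congr_of_eventuallyEq hev)
      rw [h1, hγ0, hνx, cliffordElement_apply P a (deriv γ 0), ← Finset.sum_sub_distrib]
      refine Submodule.sum_mem _ fun α _ => ?_
      rw [h.inner_apply_cliffordElement hx, add_sub_cancel_left]
      exact Submodule.smul_mem _ _ (hPS α)
    | zero => simp
    | add y z _ _ hy hz =>
      rw [map_add, map_add, add_sub_add_comm]
      exact Submodule.add_mem _ hy hz
    | smul c y _ hy =>
      rw [map_smul, map_smul, ← smul_sub]
      exact Submodule.smul_mem _ _ hy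
  have hperp : S ≤ (tangentSpace (focalM1 P) x)ᗮ := by
    rw [hS, Submodule.span_le]
    rintro _ ⟨α, rfl⟩
    rw [SetLike.mem_coe, Submodule.mem_orthogonal]
    intro Y hY
    rw [real_inner_comm]
    exact ((h.mem_tangentSpace' hx).1 hY).2 α
  have hX := (h.mem_tangentSpace' hx).1 X.2
  have hQX : (inner ℝ x (cliffordElement P a X) : ℝ) = 0 := by
    rw [cliffordElement_apply, inner_sum]
    refine Finset.sum_eq_zero fun α _ => ?_
    rw [real_inner_smul_right, ← h.inner_left, hX.2, mul_zero]
  have hmem := h.tangentialPart_mem_tangentSpace hx hQX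
  have hdiff : fderiv ℝ ν x X - tangentialPart P x (cliffordElement P a X) ∈ S := by
    rw [tangentialPart_apply, ← sub_add]
    exact Submodule.add_mem _ (key X X.2)
      (Submodule.sum_mem _ fun α _ => Submodule.smul_mem _ _ (hPS α))
  have h0 := Submodule.orthogonalProjectionOnto_apply_of_mem_orthogonal (hperp hdiff)
  have h1 := (tangentSpace (focalM1 P) x).orthogonalProjectionOnto_mem_subspace_eq_self
    ⟨_, hmem⟩
  rw [map_sub, sub_eq_zero, h1] at h0
  have h2 := congrArg (fun Y : tangentSpace (focalM1 P) x => -(Y : E)) h0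
  exact h2

end IsCliffordSystem
end OTFKM

namespace OTFKM

/-! ### Change of the Clifford system by an orthonormal frame -/

section ChangeOfFrame

variable {E : Type*} [NormedAddCommGroup E] [InnerProductSpace ℝ E]
  {m : ℕ} {P : Fin (m + 1) → E →L[ℝ] E}

theorem cliffordElement_single (P : Fin (m + 1) → E →L[ℝ] E) (α : Fin (m + 1)) :
    cliffordElement P (EuclideanSpace.single α 1) = P α := by
  simp [cliffordElement, PiLp.single_apply, ite_smul]

theorem cliffordElement_smul (P : Fin (m + 1) → E →L[ℝ] E) (c : ℝ)
    (a : EuclideanSpace ℝ (Fin (m + 1))) : cliffordElement P (c • a) = c • cliffordElement P a := by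
  simp [cliffordElement, Finset.smul_sum, mul_smul]

theorem sum_mul_of_orthonormal {a : Fin (m + 1) → EuclideanSpace ℝ (Fin (m + 1))}
    (ha : Orthonormal ℝ a) (α β : Fin (m + 1)) :
    ∑ i, a i α * a i β = if α = β then 1 else 0 := by
  let b := OrthonormalBasis.mk ha
    ((ha.linearIndependent.span_eq_top_of_card_eq_finrank (by simp)).ge)
  have hb : ∀ i, b i = a i := fun i => by simp [b]
  have h := b.sum_inner_mul_inner (EuclideanSpace.single α (1 : ℝ)) (EuclideanSpace.single β 1)
  simpa [hb, EuclideanSpace.inner_single_left, EuclideanSpace.inner_single_right,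
    PiLp.single_apply, eq_comm] using h

theorem sum_smul_cliffordElement (P : Fin (m + 1) → E →L[ℝ] E)
    {a : Fin (m + 1) → EuclideanSpace ℝ (Fin (m + 1))} (ha : Orthonormal ℝ a)
    (α : Fin (m + 1)) (x : E) : ∑ i, a i α • cliffordElement P (a i) x = P α x := by
  simp only [cliffordElement_apply, Finset.smul_sum, smul_smul]
  rw [Finset.sum_comm]
  simp [← Finset.sum_smul, sum_mul_of_orthonormal ha, ite_smul]

namespace IsCliffordSystem

theorem cliffordElement_mul_add (h : IsCliffordSystem P)
    (a b : EuclideanSpace ℝ (Fin (m + 1))) :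
    cliffordElement P a * cliffordElement P b + cliffordElement P b * cliffordElement P a
      = (2 * inner ℝ a b : ℝ) • 1 := by
  simp only [cliffordElement, Finset.sum_mul_sum]
  conv_lhs => arg 2; rw [Finset.sum_comm]
  simp only [← Finset.sum_add_distrib, smul_mul_smul_comm]
  have h1 : ∀ α β, (a α * b β) • (P α * P β) + (b β * a α) • (P β * P α)
      = if α = β then (2 * (a α * b β)) • (1 : E →L[ℝ] E) else 0 := by
    intro α β
    rw [mul_comm (b β), ← smul_add, h.anticomm]
    split_ifs
    · rw [mul_comm 2 (a α * b β), mul_smul (a α * b β), two_smul ℝ (1 : E →L[ℝ] E),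
        one_add_one_eq_two]
    · exact smul_zero _
  simp only [h1, Finset.sum_ite_eq, Finset.mem_univ, if_true]
  rw [← Finset.sum_smul, ← Finset.mul_sum, PiLp.inner_apply]
  simp [mul_comm]

theorem of_orthonormal (h : IsCliffordSystem P)
    {a : Fin (m + 1) → EuclideanSpace ℝ (Fin (m + 1))} (ha : Orthonormal ℝ a) :
    IsCliffordSystem fun i => cliffordElement P (a i) where
  symmetric i x y := by
    change (inner ℝ (cliffordElement P (a i) x) y : ℝ) = inner ℝ x (cliffordElement P (a i) y)
    simp only [cliffordElement_apply, sum_inner, inner_sum, real_inner_smul_left,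
      real_inner_smul_right, h.inner_left]
  anticomm i j := by
    rw [h.cliffordElement_mul_add, orthonormal_iff_ite.1 ha]
    split_ifs
    · rw [mul_one, two_smul, one_add_one_eq_two]
    · simp

end IsCliffordSystem

theorem focalM1_of_orthonormal (P : Fin (m + 1) → E →L[ℝ] E)
    {a : Fin (m + 1) → EuclideanSpace ℝ (Fin (m + 1))} (ha : Orthonormal ℝ a) :
    focalM1 (fun i => cliffordElement P (a i)) = focalM1 P := by
  ext x
  rw [IsCliffordSystem.mem_focalM1, IsCliffordSystem.mem_focalM1]
  refine and_congr_right fun _ => ⟨fun h α => ?_, fun h i => ?_⟩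
  · rw [← sum_smul_cliffordElement P ha, sum_inner]
    simp [real_inner_smul_left, h]
  · rw [cliffordElement_apply, sum_inner]
    simp [real_inner_smul_left, h]

theorem IsCliffordSystem.inner_cliffordElement (h : IsCliffordSystem P) {x : E}
    (hx : x ∈ focalM1 P) (a b : EuclideanSpace ℝ (Fin (m + 1))) :
    (inner ℝ (cliffordElement P a x) (cliffordElement P b x) : ℝ) = inner ℝ a b := by
  rw [cliffordElement_apply P a, sum_inner, PiLp.inner_apply]
  refine Finset.sum_congr rfl fun α _ => ?_
  rw [real_inner_smul_left, h.inner_apply_cliffordElement hx]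
  simp [mul_comm]

end ChangeOfFrame

/-! ### The common kernel of the shape operators -/

section CommonKernel

variable {E : Type*} [NormedAddCommGroup E] [InnerProductSpace ℝ E]
  {m : ℕ} {P : Fin (m + 1) → E →L[ℝ] E}

/-- The tangent vectors `X` for which all the vectors `P_α X` are normal. It is the common kernel
of all the shape operators at `x`. -/
def asymptoticSpace (P : Fin (m + 1) → E →L[ℝ] E) (x : E) : Submodule ℝ E :=
  tangentSpace (focalM1 P) x ⊓ ⨅ α, LinearMap.ker (tangentialPart P x ∘L P α).toLinearMap

theorem mem_asymptoticSpace {x X : E} : X ∈ asymptoticSpace P x ↔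
    X ∈ tangentSpace (focalM1 P) x ∧ ∀ α, tangentialPart P x (P α X) = 0 := by
  simp [asymptoticSpace, Submodule.mem_iInf]

theorem sum_norm_sq_eq_zero_iff {x X : E} (hX : X ∈ tangentSpace (focalM1 P) x) :
    ∑ α, ‖tangentialPart P x (P α X)‖ ^ 2 = 0 ↔ X ∈ asymptoticSpace P x := by
  rw [Finset.sum_eq_zero_iff_of_nonneg fun _ _ => sq_nonneg _, mem_asymptoticSpace]
  simp [hX]

namespace IsCliffordSystem

theorem inner_apply_apply_left (h : IsCliffordSystem P) {x : E} {i k l : Fin (m + 1)}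
    (hik : i ≠ k) (hil : i ≠ l) :
    (inner ℝ (P i (P k x)) (P k (P l x)) : ℝ) = 0 := by
  rw [h.apply_apply_comm hik, inner_neg_left, h.inner_apply_apply_same,
    h.inner_apply_apply_of_ne hil, neg_zero]

/-- If all the `P_α X` are normal, then `X = P_i (P_i X)` is a combination of the `P_i P_β x`. -/
theorem eq_sum_of_mem_asymptoticSpace (h : IsCliffordSystem P) {x X : E}
    (hX : X ∈ asymptoticSpace P x) (i : Fin (m + 1)) :
    X = ∑ β, (inner ℝ (P i (P β x)) X : ℝ) • P i (P β x) := by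
  have h1 := (mem_asymptoticSpace.1 hX).2 i
  rw [tangentialPart_apply, sub_eq_zero] at h1
  have h2 := congrArg (P i) h1
  rw [h.apply_apply_self, map_sum] at h2
  simpa only [map_smul, h.inner_left] using h2

variable [FiniteDimensional ℝ E]

/-- The common kernel does not depend on the orthonormal normal frame, because the shape operator
is linear in the normal vector. -/
theorem map_commonKernel (h : IsCliffordSystem P) {x : E} (hx : x ∈ focalM1 P)
    {N : Fin (m + 1) → E} (hN : IsOrthonormalNormal (focalM1 P) x N) :
    (commonKernel (focalM1 P) x N).map (tangentSpace (focalM1 P) x).subtype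
      = asymptoticSpace P x := by
  have hex : ∀ i, ∃ a : EuclideanSpace ℝ (Fin (m + 1)), N i = cliffordElement P a x := by
    intro i
    refine ⟨WithLp.toLp 2 fun α => inner ℝ (P α x) (N i), ?_⟩
    rw [cliffordElement_apply]
    exact (h.mem_normalSpace hx).1 (hN.2 i)
  choose a ha using hex
  have hao : Orthonormal ℝ a := by
    rw [orthonormal_iff_ite]
    intro i j
    rw [← h.inner_cliffordElement hx, ← ha, ← ha]
    exact orthonormal_iff_ite.1 hN.1 i j
  have hker : ∀ (X : tangentSpace (focalM1 P) x) i, shapeOperator (focalM1 P) x (N i) X = 0 ↔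
      tangentialPart P x (cliffordElement P (a i) X) = 0 := by
    intro X i
    rw [← Submodule.coe_eq_zero, ha i, h.shapeOperator_cliffordElement hx, neg_eq_zero]
  ext X
  simp only [Submodule.mem_map, commonKernel, Submodule.mem_iInf, LinearMap.mem_ker,
    mem_asymptoticSpace, hker]
  constructor
  · rintro ⟨X, hX, rfl⟩
    refine ⟨X.2, fun α => ?_⟩
    rw [← sum_smul_cliffordElement P hao, map_sum]
    refine Finset.sum_eq_zero fun i _ => ?_
    rw [map_smul]
    exact (congrArg _ (hX i)).trans (smul_zero _)
  · rintro ⟨hXT, hX⟩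
    refine ⟨⟨X, hXT⟩, fun i => ?_, rfl⟩
    rw [cliffordElement_apply, map_sum]
    refine Finset.sum_eq_zero fun α _ => ?_
    rw [map_smul, hX, smul_zero]

theorem finrank_commonKernel (h : IsCliffordSystem P) {x : E} (hx : x ∈ focalM1 P)
    {N : Fin (m + 1) → E} (hN : IsOrthonormalNormal (focalM1 P) x N) :
    Module.finrank ℝ (commonKernel (focalM1 P) x N)
      = Module.finrank ℝ (asymptoticSpace P x) := by
  rw [← h.map_commonKernel hx hN, Submodule.finrank_map_subtype_eq]

theorem isOrthonormalNormal (h : IsCliffordSystem P) {x : E} (hx : x ∈ focalM1 P) :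
    IsOrthonormalNormal (focalM1 P) x fun α => P α x := by
  refine ⟨h.orthonormal_apply hx, fun α => ?_⟩
  have := h.cliffordElement_mem_normalSpace hx (EuclideanSpace.single α 1)
  rwa [cliffordElement_single] at this

theorem asymptoticSpace_of_orthonormal (h : IsCliffordSystem P) {x : E} (hx : x ∈ focalM1 P)
    {a : Fin (m + 1) → EuclideanSpace ℝ (Fin (m + 1))} (ha : Orthonormal ℝ a) :
    asymptoticSpace (fun i => cliffordElement P (a i)) x = asymptoticSpace P x := by
  have hQ := h.of_orthonormal ha
  have hM := focalM1_of_orthonormal P ha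
  have hx' : x ∈ focalM1 fun i => cliffordElement P (a i) := hM ▸ hx
  have hN := hQ.isOrthonormalNormal hx'
  rw [← hQ.map_commonKernel hx' hN]
  rw [hM] at hN ⊢
  exact h.map_commonKernel hx hN

theorem inner_self_of_mem_asymptoticSpace (h : IsCliffordSystem P) {x X : E}
    (hx : x ∈ focalM1 P) (hX : X ∈ asymptoticSpace P x) (i : Fin (m + 1)) :
    (inner ℝ (P i (P i x)) X : ℝ) = 0 := by
  rw [h.apply_apply_self]
  exact ((h.mem_tangentSpace' hx).1 (mem_asymptoticSpace.1 hX).1).1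

/-- The vectors `P_i P_j x`, `i ≠ j`, are tangent to the focal submanifold. -/
theorem apply_apply_mem_tangentSpace (h : IsCliffordSystem P) {x : E} (hx : x ∈ focalM1 P)
    {i j : Fin (m + 1)} (hij : i ≠ j) : P i (P j x) ∈ tangentSpace (focalM1 P) x := by
  have h0 := mem_focalM1.1 hx
  rw [h.mem_tangentSpace' hx]
  refine ⟨by rw [← h.inner_left]; exact h.inner_apply_apply_of_ne hij x, fun k => ?_⟩
  by_cases hki : k = i
  · rw [hki, h.inner_apply_apply_same, ← h.inner_left]
    exact h0.2 j
  by_cases hkj : k = j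
  · rw [hkj, h.apply_apply_comm hij, inner_neg_right, h.inner_apply_apply_same, ← h.inner_left,
      h0.2, neg_zero]
  -- `P_k P_i P_j` is skew-symmetric
  have h1 : (inner ℝ (P k x) (P i (P j x)) : ℝ) = -inner ℝ (P k x) (P i (P j x)) := by
    conv_lhs => rw [← h.inner_left, h.apply_apply_comm (Ne.symm hki), inner_neg_left,
      h.inner_left, h.apply_apply_comm hkj, inner_neg_right, neg_neg, ← h.inner_left,
      h.apply_apply_comm hij.symm, inner_neg_left, real_inner_comm]
  linarith

end IsCliffordSystem

end CommonKernel

/-! ### Clifford systems of four operators -/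

section Four

variable {E : Type*} [NormedAddCommGroup E] [InnerProductSpace ℝ E]
  {P : Fin (3 + 1) → E →L[ℝ] E}

namespace IsCliffordSystem

theorem anticomm_four (h : IsCliffordSystem P) :
    (∀ y, P 1 (P 0 y) = -P 0 (P 1 y)) ∧ (∀ y, P 2 (P 0 y) = -P 0 (P 2 y)) ∧
    (∀ y, P 3 (P 0 y) = -P 0 (P 3 y)) ∧ (∀ y, P 2 (P 1 y) = -P 1 (P 2 y)) ∧
    (∀ y, P 3 (P 1 y) = -P 1 (P 3 y)) ∧ ∀ y, P 3 (P 2 y) = -P 2 (P 3 y) :=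
  ⟨h.apply_apply_comm (by decide), h.apply_apply_comm (by decide),
    h.apply_apply_comm (by decide), h.apply_apply_comm (by decide),
    h.apply_apply_comm (by decide), h.apply_apply_comm (by decide)⟩

theorem eq_smul_of_inner_sq_eq_one {u v : E} (hu : ‖u‖ = 1) (hv : ‖v‖ = 1)
    (huv : (inner ℝ u v : ℝ) ^ 2 = 1) : u = (inner ℝ u v : ℝ) • v := by
  have h1 : ‖u - (inner ℝ u v : ℝ) • v‖ ^ 2 = 0 := by
    rw [norm_sub_sq_real, real_inner_smul_right, norm_smul, hu, hv, mul_one, Real.norm_eq_abs,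
      sq_abs, ← sq, huv]
    norm_num
  exact sub_eq_zero.1 (norm_eq_zero.1 (pow_eq_zero_iff two_ne_zero |>.1 h1))

/-- The frame is `c P_j, P_i, P_k, P_l`, since `P_j P_i P_k P_l x = c x`. -/
theorem mem_omegaSet (h : IsCliffordSystem P) {x : E} (hx : x ∈ focalM1 P)
    {i j k l : Fin (3 + 1)} (hij : i ≠ j) (hik : i ≠ k) (hil : i ≠ l) (hjk : j ≠ k) (hjl : j ≠ l)
    (hkl : k ≠ l) {c : ℝ} (hc : c ^ 2 = 1) (hijkl : P i (P j x) = c • P k (P l x)) :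
    x ∈ omegaSet P := by
  refine ⟨hx, ![c • EuclideanSpace.single j 1, EuclideanSpace.single i 1,
    EuclideanSpace.single k 1, EuclideanSpace.single l 1], ?_, ?_⟩
  · rw [orthonormal_iff_ite]
    intro s t
    have hcc : |c| = 1 := by
      rw [← sq_eq_sq₀ (abs_nonneg c) zero_le_one, sq_abs, hc, one_pow]
    fin_cases s <;> fin_cases t <;>
      simp [real_inner_smul_left, norm_smul,
        EuclideanSpace.inner_single_left, hij, hik, hil, hjk, hjl, hkl, hij.symm, hik.symm, hil.symm, hjk.symm,
        hjl.symm, hkl.symm, hcc]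
  · simp only [Matrix.cons_val, cliffordElement_smul, cliffordElement_single, smul_apply]
    have h1 : P k (P l x) = c • P i (P j x) := by
      rw [hijkl, smul_smul, ← sq, hc, one_smul]
    rw [h1, map_smul, h.apply_apply_self, map_smul, h.apply_apply_self, smul_smul, ← sq, hc,
      one_smul]

variable [FiniteDimensional ℝ E]

theorem asymptoticSpace_le_span (h : IsCliffordSystem P) {x : E} (hx : x ∈ focalM1 P) :
    asymptoticSpace P x ≤ Submodule.span ℝ (Set.range fun j : Fin 3 => P 0 (P j.succ x)) := by
  intro X hX
  rw [h.eq_sum_of_mem_asymptoticSpace hX 0, Fin.sum_univ_succ,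
    h.inner_self_of_mem_asymptoticSpace hx hX, zero_smul, zero_add]
  exact Submodule.sum_mem _ fun j _ => Submodule.smul_mem _ _ (Submodule.subset_span ⟨j, rfl⟩)

theorem finrank_asymptoticSpace_le (h : IsCliffordSystem P) {x : E} (hx : x ∈ focalM1 P) :
    Module.finrank ℝ (asymptoticSpace P x) ≤ 3 :=
  (Submodule.finrank_mono (h.asymptoticSpace_le_span hx)).trans
    ((finrank_range_le_card _).trans (by simp))

/-- The vectors `P₀ P_j x`, `j ≠ 0`, are orthonormal and lie in the common kernel, because
`P_i P_j x = ± P_k P_l x` for any numbering of the four indices. -/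
theorem three_le_finrank_asymptoticSpace (h : IsCliffordSystem P) {x : E} (hx : x ∈ focalM1 P)
    (hP : P 0 (P 1 (P 2 (P 3 x))) = x) : 3 ≤ Module.finrank ℝ (asymptoticSpace P x) := by
  obtain ⟨h10, h20, h30, h21, h31, h32⟩ := h.anticomm_four
  have hs := h.apply_apply_self
  have e1 : P 0 (P 1 x) = -P 2 (P 3 x) := by
    conv_lhs => rw [← hP]
    simp [h10, hs]
  have e2 : P 0 (P 2 x) = P 1 (P 3 x) := by
    conv_lhs => rw [← hP]
    simp [h20, h21, hs]
  have e3 : P 0 (P 3 x) = -P 1 (P 2 x) := by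
    conv_lhs => rw [← hP]
    simp [h30, h31, h32, hs]
  have ho : Orthonormal ℝ fun j : Fin 3 => P 0 (P j.succ x) := by
    refine ⟨fun j => ?_, fun i j hij => ?_⟩
    · rw [h.norm_apply, h.norm_apply]
      exact (mem_focalM1.1 hx).1
    · change (inner ℝ (P 0 (P i.succ x)) (P 0 (P j.succ x)) : ℝ) = 0
      rw [h.inner_apply_apply_same]
      exact h.inner_apply_apply_of_ne (fun hij' => hij (Fin.succ_injective _ hij')) x
  have htp : ∀ β, tangentialPart P x (P β x) = 0 := by
    intro β
    rw [tangentialPart_apply, sub_eq_zero]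
    have := orthonormal_iff_ite.1 (h.orthonormal_apply hx)
    simp [this]
  have hle : Submodule.span ℝ (Set.range fun j : Fin 3 => P 0 (P j.succ x))
      ≤ asymptoticSpace P x := by
    rw [Submodule.span_le]
    rintro _ ⟨j, rfl⟩
    rw [SetLike.mem_coe, mem_asymptoticSpace]
    refine ⟨h.apply_apply_mem_tangentSpace hx (Fin.succ_ne_zero j).symm, fun α => ?_⟩
    have hneg : ∀ β, tangentialPart P x (-P β x) = 0 := fun β => by rw [map_neg, htp, neg_zero]
    fin_cases j
    · change tangentialPart P x (P α (P 0 (P 1 x))) = 0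
      fin_cases α
      · simp [hs, htp]
      · simp [h10, hs, htp]
      · simp [e1, hs, htp]
      · simp [e1, h32, hs, htp]
    · change tangentialPart P x (P α (P 0 (P 2 x))) = 0
      fin_cases α
      · simp [hs, htp]
      · simp [e2, hs, htp]
      · simp [h20, hs, htp]
      · simp [e2, h31, hs, htp]
    · change tangentialPart P x (P α (P 0 (P 3 x))) = 0
      fin_cases α
      · simp [hs, htp]
      · simp [e3, hs, htp]
      · simp [e3, h21, hs, htp]
      · simp [h30, hs, htp]
  have := Submodule.finrank_mono hle
  rwa [finrank_span_eq_card ho.linearIndependent, Fintype.card_fin] at this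

theorem finrank_asymptoticSpace_of_mem_omegaSet (h : IsCliffordSystem P) {x : E}
    (hx : x ∈ omegaSet P) : Module.finrank ℝ (asymptoticSpace P x) = 3 := by
  obtain ⟨hxM, a, ha, hax⟩ := hx
  refine le_antisymm (h.finrank_asymptoticSpace_le hxM) ?_
  rw [← h.asymptoticSpace_of_orthonormal hxM ha]
  refine (h.of_orthonormal ha).three_le_finrank_asymptoticSpace ?_ hax
  rw [focalM1_of_orthonormal P ha]
  exact hxM

/-- Expand `X` in the vectors `P_i P_β x`, and note that only `β = j` contributes to the inner
product with `P_k P_l x`. -/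
theorem inner_eq_mul_inner (h : IsCliffordSystem P) {x X : E} (hx : x ∈ focalM1 P)
    (hX : X ∈ asymptoticSpace P x) {i j k l : Fin (3 + 1)} (hik : i ≠ k) (hil : i ≠ l)
    (hcover : ∀ β, β = i ∨ β = j ∨ β = k ∨ β = l) :
    (inner ℝ (P k (P l x)) X : ℝ)
      = inner ℝ (P i (P j x)) X * inner ℝ (P i (P j x)) (P k (P l x)) := by
  conv_lhs => rw [real_inner_comm, h.eq_sum_of_mem_asymptoticSpace hX i, sum_inner]
  refine (Finset.sum_eq_single j (fun β _ hβ => ?_) (by simp)).trans (real_inner_smul_left _ _ _)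
  rw [real_inner_smul_left]
  rcases hcover β with rfl | rfl | rfl | rfl
  · rw [h.inner_self_of_mem_asymptoticSpace hx hX, zero_mul]
  · exact absurd rfl hβ
  · rw [h.inner_apply_apply_left hik hil, mul_zero]
  · rw [h.inner_apply_apply_of_ne hik, mul_zero]

/-- Exchange the roles of the two pairs of indices in `inner_eq_mul_inner`. -/
theorem inner_sq_eq_one (h : IsCliffordSystem P) {x X : E} (hx : x ∈ focalM1 P)
    (hX : X ∈ asymptoticSpace P x) {i j k l : Fin (3 + 1)} (hik : i ≠ k) (hil : i ≠ l)
    (hjk : j ≠ k) (hcover : ∀ β, β = i ∨ β = j ∨ β = k ∨ β = l)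
    (hne : (inner ℝ (P i (P j x)) X : ℝ) ≠ 0) :
    (inner ℝ (P i (P j x)) (P k (P l x)) : ℝ) ^ 2 = 1 := by
  have h1 := h.inner_eq_mul_inner hx hX hik hil hcover
  have h2 := h.inner_eq_mul_inner hx hX (i := k) (j := l) (k := i) (l := j) hik.symm hjk.symm
    (fun β => by have := hcover β; tauto)
  rw [h1, real_inner_comm (P i (P j x)) (P k (P l x))] at h2
  refine mul_left_cancel₀ hne ?_
  linarith

/-- A nonzero vector in the common kernel forces `⟨P₀ P_j x, P_k P_l x⟩ = ±1` for some splitting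
`{0, j}, {k, l}` of the indices. -/
theorem exists_inner_sq_eq_one (h : IsCliffordSystem P) {x X : E} (hx : x ∈ focalM1 P)
    (hX : X ∈ asymptoticSpace P x) (hX0 : X ≠ 0) :
    (inner ℝ (P 0 (P 1 x)) (P 2 (P 3 x)) : ℝ) ^ 2 = 1 ∨
    (inner ℝ (P 0 (P 2 x)) (P 1 (P 3 x)) : ℝ) ^ 2 = 1 ∨
    (inner ℝ (P 0 (P 3 x)) (P 1 (P 2 x)) : ℝ) ^ 2 = 1 := by
  by_contra! hcon
  have h0 : ∀ j : Fin (3 + 1), (inner ℝ (P 0 (P j x)) X : ℝ) = 0 := by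
    intro j
    by_contra hne
    fin_cases j
    · exact hne (h.inner_self_of_mem_asymptoticSpace hx hX 0)
    · exact hcon.1 (h.inner_sq_eq_one hx hX (by decide) (by decide) (by decide) (by decide) hne)
    · exact hcon.2.1
        (h.inner_sq_eq_one hx hX (by decide) (by decide) (by decide) (by decide) hne)
    · exact hcon.2.2
        (h.inner_sq_eq_one hx hX (by decide) (by decide) (by decide) (by decide) hne)
  apply hX0
  rw [h.eq_sum_of_mem_asymptoticSpace hX 0]
  simp [h0]

theorem mem_omegaSet_of_mem_asymptoticSpace (h : IsCliffordSystem P) {x X : E}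
    (hx : x ∈ focalM1 P) (hX : X ∈ asymptoticSpace P x) (hX0 : X ≠ 0) : x ∈ omegaSet P := by
  have hn : ∀ i j, ‖P i (P j x)‖ = 1 := fun i j => by
    rw [h.norm_apply, h.norm_apply, (mem_focalM1.1 hx).1]
  rcases h.exists_inner_sq_eq_one hx hX hX0 with hc | hc | hc <;>
    exact h.mem_omegaSet hx (by decide) (by decide) (by decide) (by decide) (by decide)
      (by decide) hc (eq_smul_of_inner_sq_eq_one (hn _ _) (hn _ _) hc)

/-- The inner products in `exists_inner_sq_eq_one` are `± ⟨x, P₀ P₁ P₂ P₃ x⟩`. -/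
theorem notMem_omegaSet (h : IsCliffordSystem P) {x : E}
    (hP : (inner ℝ x (P 0 (P 1 (P 2 (P 3 x)))) : ℝ) = 0) : x ∉ omegaSet P := by
  intro hx
  have hpos : 0 < Module.finrank ℝ (asymptoticSpace P x) := by
    rw [h.finrank_asymptoticSpace_of_mem_omegaSet hx]
    norm_num
  have : Nontrivial (asymptoticSpace P x) := Module.nontrivial_of_finrank_pos hpos
  obtain ⟨X, hX0⟩ := exists_ne (0 : asymptoticSpace P x)
  obtain ⟨h10, h20, h30, h21, h31, h32⟩ := h.anticomm_four
  rcases h.exists_inner_sq_eq_one hx.1 X.2 (fun h0 => hX0 (Subtype.ext h0)) with hc | hc | hc <;>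
  · rw [h.inner_left, h.inner_left] at hc
    simp [h10, h20, h30, h21, h31, h32, hP] at hc

end IsCliffordSystem

end Four

end OTFKM

namespace OTFKM

/-! ### Points inside and outside `Ω` -/

section Existence

variable {E : Type*} [NormedAddCommGroup E] [InnerProductSpace ℝ E]
  {P : Fin (3 + 1) → E →L[ℝ] E}

/-- The product `P₀ P₁ P₂ P₃`, a symmetric involution which anticommutes with every `P_α`. -/
def cliffordVolume (P : Fin (3 + 1) → E →L[ℝ] E) : E →L[ℝ] E := P 0 ∘L P 1 ∘L P 2 ∘L P 3

theorem cliffordVolume_apply (P : Fin (3 + 1) → E →L[ℝ] E) (x : E) :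
    cliffordVolume P x = P 0 (P 1 (P 2 (P 3 x))) := rfl

namespace IsCliffordSystem

theorem cliffordVolume_involutive (h : IsCliffordSystem P) (x : E) :
    cliffordVolume P (cliffordVolume P x) = x := by
  obtain ⟨h10, h20, h30, h21, h31, h32⟩ := h.anticomm_four
  simp [cliffordVolume_apply, h10, h20, h30, h21, h31, h32, h.apply_apply_self]

theorem cliffordVolume_apply_apply (h : IsCliffordSystem P) (α : Fin (3 + 1)) (x : E) :
    cliffordVolume P (P α x) = -P α (cliffordVolume P x) := by
  obtain ⟨h10, h20, h30, h21, h31, h32⟩ := h.anticomm_four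
  fin_cases α <;>
    simp [cliffordVolume_apply, h10, h20, h30, h21, h31, h32, h.apply_apply_self]

theorem inner_cliffordVolume_left (h : IsCliffordSystem P) (x y : E) :
    (inner ℝ (cliffordVolume P x) y : ℝ) = inner ℝ x (cliffordVolume P y) := by
  obtain ⟨h10, h20, h30, h21, h31, h32⟩ := h.anticomm_four
  simp [cliffordVolume_apply, h.inner_left, h10, h20, h30, h21, h31, h32]

/-- The `P_α` exchange the two eigenspaces of the volume element. -/
theorem inner_apply_eq_zero (h : IsCliffordSystem P) {x y : E} {c : ℝ} (hc : c ≠ 0)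
    (hx : cliffordVolume P x = c • x) (hy : cliffordVolume P y = c • y) (α : Fin (3 + 1)) :
    (inner ℝ (P α x) y : ℝ) = 0 := by
  have h1 : (inner ℝ (cliffordVolume P (P α x)) y : ℝ)
      = inner ℝ (P α x) (cliffordVolume P y) := h.inner_cliffordVolume_left _ _
  rw [h.cliffordVolume_apply_apply, hx, hy, map_smul, inner_neg_left, real_inner_smul_left,
    real_inner_smul_right] at h1
  have h2 : c * (inner ℝ (P α x) y : ℝ) = 0 := by linarith
  exact (mul_eq_zero.1 h2).resolve_left hc

theorem exists_cliffordVolume_eq_self [Nontrivial E] (h : IsCliffordSystem P) :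
    ∃ x : E, ‖x‖ = 1 ∧ cliffordVolume P x = x := by
  suffices ∃ x : E, x ≠ 0 ∧ cliffordVolume P x = x by
    obtain ⟨x, hx0, hx⟩ := this
    exact ⟨‖x‖⁻¹ • x, norm_smul_inv_norm hx0, by rw [map_smul, hx]⟩
  obtain ⟨z, hz⟩ := exists_ne (0 : E)
  by_cases hz' : z + cliffordVolume P z = 0
  · refine ⟨P 0 z, fun h0 => hz ?_, ?_⟩
    · rw [← h.apply_apply_self 0 z, h0, map_zero]
    · rw [h.cliffordVolume_apply_apply, ← map_neg, ← eq_neg_of_add_eq_zero_left hz']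
  · exact ⟨_, hz', by rw [map_add, h.cliffordVolume_involutive, add_comm]⟩

theorem mem_omegaSet_of_cliffordVolume_eq (h : IsCliffordSystem P) {x : E} (hx1 : ‖x‖ = 1)
    (hx : cliffordVolume P x = x) : x ∈ omegaSet P := by
  have hx' : cliffordVolume P x = (1 : ℝ) • x := by rw [hx, one_smul]
  refine ⟨mem_focalM1.2 ⟨hx1, h.inner_apply_eq_zero one_ne_zero hx' hx'⟩,
    fun i => EuclideanSpace.single i 1, ?_, ?_⟩
  · exact EuclideanSpace.orthonormal_single
  · simp only [cliffordElement_single]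
    exact hx

/-- If `x` is in the eigenspace for `1`, then the eigenspace for `-1` contains a unit vector
orthogonal to the four vectors `P_α x`, as soon as the dimension is greater than eight. -/
theorem exists_cliffordVolume_eq_neg [FiniteDimensional ℝ E] (h : IsCliffordSystem P)
    (hd : 8 < Module.finrank ℝ E) {x : E} (hx : cliffordVolume P x = x) :
    ∃ y : E, ‖y‖ = 1 ∧ cliffordVolume P y = -y ∧ ∀ α, (inner ℝ (P α x) y : ℝ) = 0 := by
  suffices ∃ y : E, y ≠ 0 ∧ cliffordVolume P y = -y ∧ ∀ α, (inner ℝ (P α x) y : ℝ) = 0 by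
    obtain ⟨y, hy0, hy, hy'⟩ := this
    exact ⟨‖y‖⁻¹ • y, norm_smul_inv_norm hy0, by rw [map_smul, hy, smul_neg],
      fun α => by rw [real_inner_smul_right, hy', mul_zero]⟩
  let f : Fin (3 + 1) ⊕ Fin (3 + 1) → E := Sum.elim (fun α => P α x) fun α => P 0 (P α x)
  have hspan : Module.finrank ℝ (Submodule.span ℝ (Set.range f)) ≤ 8 :=
    (finrank_range_le_card f).trans (by simp)
  have hperp := Submodule.finrank_add_finrank_orthogonal (Submodule.span ℝ (Set.range f))
  have : Nontrivial (Submodule.span ℝ (Set.range f))ᗮ :=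
    Module.nontrivial_of_finrank_pos (R := ℝ) (by omega)
  obtain ⟨⟨z, hzmem⟩, hz⟩ := exists_ne (0 : (Submodule.span ℝ (Set.range f))ᗮ)
  have hz0 : z ≠ 0 := fun h0 => hz (Subtype.ext h0)
  have hf : ∀ s, (inner ℝ (f s) z : ℝ) = 0 := fun s =>
    (Submodule.mem_orthogonal _ _).1 hzmem _ (Submodule.subset_span ⟨s, rfl⟩)
  by_cases hz' : z - cliffordVolume P z = 0
  · -- then `z` is in the eigenspace for `1`, and `P₀ z` is in the other one
    refine ⟨P 0 z, fun h0 => hz0 ?_, ?_, fun α => ?_⟩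
    · rw [← h.apply_apply_self 0 z, h0, map_zero]
    · rw [h.cliffordVolume_apply_apply, ← sub_eq_zero.1 hz']
    · rw [← h.inner_left]
      exact hf (Sum.inr α)
  · refine ⟨_, hz', by rw [map_sub, h.cliffordVolume_involutive, neg_sub], fun α => ?_⟩
    have h1 : (inner ℝ (P α x) z : ℝ) = 0 := hf (Sum.inl α)
    rw [inner_sub_right, h1, ← h.inner_cliffordVolume_left, h.cliffordVolume_apply_apply, hx,
      inner_neg_left, h1, neg_zero, sub_zero]

theorem omegaSet_nonempty [Nontrivial E] (h : IsCliffordSystem P) : (omegaSet P).Nonempty := by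
  obtain ⟨x, hx1, hx⟩ := h.exists_cliffordVolume_eq_self
  exact ⟨x, h.mem_omegaSet_of_cliffordVolume_eq hx1 hx⟩

/-- The focal submanifold contains `(x + y) / √2` with `x`, `y` in different eigenspaces of the
volume element, and such a point is not in `Ω`. -/
theorem exists_notMem_omegaSet [FiniteDimensional ℝ E] (h : IsCliffordSystem P)
    (hd : 8 < Module.finrank ℝ E) : ∃ y ∈ focalM1 P, y ∉ omegaSet P := by
  have : Nontrivial E := Module.nontrivial_of_finrank_pos (R := ℝ) (by omega)
  obtain ⟨x, hx1, hx⟩ := h.exists_cliffordVolume_eq_self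
  obtain ⟨y, hy1, hy, hxy⟩ := h.exists_cliffordVolume_eq_neg hd hx
  have hx0 : (inner ℝ x y : ℝ) = 0 := by
    have := h.inner_cliffordVolume_left x y
    rw [hx, hy, inner_neg_right] at this
    linarith
  have hxx := h.inner_apply_eq_zero (c := 1) one_ne_zero (by rw [hx, one_smul])
    (by rw [hx, one_smul])
  have hyy := h.inner_apply_eq_zero (c := -1) (by norm_num) (by rw [hy, neg_one_smul])
    (by rw [hy, neg_one_smul])
  have hyx : ∀ α, (inner ℝ (P α y) x : ℝ) = 0 := fun α => by
    rw [h.inner_left, real_inner_comm, hxy]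
  have hs : (√2)⁻¹ ^ 2 = (2 : ℝ)⁻¹ := by rw [inv_pow, Real.sq_sqrt zero_le_two]
  refine ⟨(√2)⁻¹ • (x + y), mem_focalM1.2 ⟨?_, fun α => ?_⟩, h.notMem_omegaSet ?_⟩
  · rw [← sq_eq_sq₀ (norm_nonneg _) zero_le_one, norm_smul, mul_pow, norm_add_sq_real, hx1, hy1,
      hx0, Real.norm_eq_abs, sq_abs, hs]
    norm_num
  · rw [map_smul, real_inner_smul_left, real_inner_smul_right, map_add, inner_add_left,
      inner_add_right, inner_add_right, hxx, hxy, hyx, hyy]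
    simp
  · rw [← cliffordVolume_apply, map_smul, real_inner_smul_left, real_inner_smul_right, map_add,
      hx, hy, inner_add_left, inner_add_right, inner_add_right, inner_neg_right, inner_neg_right,
      real_inner_self_eq_norm_sq, real_inner_self_eq_norm_sq, hx1, hy1,
      real_inner_comm x y, hx0]
    simp

end IsCliffordSystem

end Existence

/-! ### Directions of maximal Ricci curvature -/

section Ricci

variable {E : Type*} [NormedAddCommGroup E] [InnerProductSpace ℝ E] [FiniteDimensional ℝ E]
  {m : ℕ} {P : Fin (m + 1) → E →L[ℝ] E}

namespace IsCliffordSystem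

theorem ricciCurvature_le (h : IsCliffordSystem P) (hm : 1 ≤ m) {n : ℕ}
    (hd : m + 2 + n = Module.finrank ℝ E) {x : E} (hx : x ∈ focalM1 P) {X : E}
    (hX : X ∈ tangentSpace (focalM1 P) x) (hX1 : ‖X‖ = 1) :
    ricciCurvature n (focalM1 P) x X ≤ (n : ℝ) - 1 := by
  rw [h.ricciCurvature_eq hm hd hx hX, hX1, one_pow, mul_one]
  exact sub_le_self _ (Finset.sum_nonneg fun _ _ => sq_nonneg _)

theorem ricciCurvature_eq_iff (h : IsCliffordSystem P) (hm : 1 ≤ m) {n : ℕ}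
    (hd : m + 2 + n = Module.finrank ℝ E) {x : E} (hx : x ∈ focalM1 P) {X : E}
    (hX : X ∈ tangentSpace (focalM1 P) x) (hX1 : ‖X‖ = 1) :
    ricciCurvature n (focalM1 P) x X = (n : ℝ) - 1 ↔ X ∈ asymptoticSpace P x := by
  rw [h.ricciCurvature_eq hm hd hx hX, hX1, one_pow, mul_one, sub_eq_self,
    sum_norm_sq_eq_zero_iff hX]

/-- A Riemannian isometry `f` preserves the points which have a unit tangent vector in the common
kernel. Indeed, `φ` and `f ∘ φ` induce the same metric, hence the same Ricci tensor. -/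
theorem exists_mem_asymptoticSpace_of_isometry (h : IsCliffordSystem P) (hm : 1 ≤ m) {n : ℕ}
    (hd : m + 2 + n = Module.finrank ℝ E) {f : E → E}
    (hf : IsRiemannianIsometry n (focalM1 P) f) {x : E} (hx : x ∈ focalM1 P) {X : E}
    (hX : X ∈ asymptoticSpace P x) (hX0 : X ≠ 0) :
    ∃ Y ∈ asymptoticSpace P (f x), Y ≠ 0 := by
  have hXT := (mem_asymptoticSpace.1 hX).1
  obtain ⟨φ, U, u, hu, v, hφ, rfl, rfl⟩ :=
    h.exists_isLocalParam hd hx ((h.mem_tangentSpace hx).1 hXT)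
  have hM : ∀ w ∈ U, φ w ∈ focalM1 P := fun _ => hφ.apply_mem
  have hψM : ∀ w ∈ U, (f ∘ φ) w ∈ focalM1 P := fun w hw => hf.mapsTo (hM w hw)
  have hψ := hf.smooth φ U hφ
  have hg := hf.isometry φ U hφ
  have hnorm : ∀ w ∈ U, ∀ a, ‖fderiv ℝ (f ∘ φ) w a‖ ^ 2 = ‖fderiv ℝ φ w a‖ ^ 2 := by
    intro w hw a
    have key : ∀ χ : (Fin n → ℝ) → E, ‖fderiv ℝ χ w a‖ ^ 2
        = ∑ i, ∑ j, a i * a j * inducedMetric χ w i j := fun χ => by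
      rw [← real_inner_self_eq_norm_sq]
      exact (IsFramedImmersion.sum_mul_inner_pd (ContinuousLinearMap.id ℝ E)
        (ContinuousLinearMap.id ℝ E) χ w a).symm
    rw [key, key, hg w hw]
  have himm : ∀ w ∈ U, Function.Injective (fderiv ℝ (f ∘ φ) w) := by
    intro w hw
    rw [injective_iff_map_eq_zero]
    intro a ha
    have h1 := hnorm w hw a
    rw [ha, norm_zero, zero_pow two_ne_zero] at h1
    exact (injective_iff_map_eq_zero _).1 (hφ.immersion w hw) a
      (norm_eq_zero.1 (pow_eq_zero_iff two_ne_zero |>.1 h1.symm))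
  have h1 := h.sum_mul_ricciTensor hm hφ.isOpen hφ.contDiffOn hφ.immersion hM hd hu v
  have h2 := h.sum_mul_ricciTensor hm hφ.isOpen hψ himm hψM hd hu v
  have h3 : inducedMetric (f ∘ φ) =ᶠ[𝓝 u] inducedMetric φ :=
    Filter.eventually_of_mem (hφ.isOpen.mem_nhds hu) hg
  simp only [ricciTensor_congr h3] at h2
  rw [h1, hnorm u hu, (sum_norm_sq_eq_zero_iff hXT).2 hX] at h2
  have hT : fderiv ℝ (f ∘ φ) u v ∈ tangentSpace (focalM1 P) (f (φ u)) := by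
    rw [h.mem_tangentSpace (hf.mapsTo hx)]
    exact fun a => (h.isFramedImmersion hφ.isOpen hψ himm hψM hd).normal u hu a v
  refine ⟨_, (sum_norm_sq_eq_zero_iff hT).1 ?_, fun h0 => hX0 ?_⟩
  · change ∑ α, ‖tangentialPart P ((f ∘ φ) u) (P α (fderiv ℝ (f ∘ φ) u v))‖ ^ 2 = 0
    linarith
  · have h4 := hnorm u hu v
    rw [h0, norm_zero, zero_pow two_ne_zero] at h4
    exact norm_eq_zero.1 (pow_eq_zero_iff two_ne_zero |>.1 h4.symm)

end IsCliffordSystem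

end Ricci

section RicciFour

variable {E : Type*} [NormedAddCommGroup E] [InnerProductSpace ℝ E] [FiniteDimensional ℝ E]
  {P : Fin (3 + 1) → E →L[ℝ] E}

namespace IsCliffordSystem

theorem exists_unit_mem_asymptoticSpace (h : IsCliffordSystem P) {x : E} (hx : x ∈ omegaSet P) :
    ∃ X ∈ asymptoticSpace P x, ‖X‖ = 1 := by
  have hpos : 0 < Module.finrank ℝ (asymptoticSpace P x) := by
    rw [h.finrank_asymptoticSpace_of_mem_omegaSet hx]
    norm_num
  have : Nontrivial (asymptoticSpace P x) := Module.nontrivial_of_finrank_pos hpos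
  obtain ⟨X, hX0⟩ := exists_ne (0 : asymptoticSpace P x)
  have hX0' : (X : E) ≠ 0 := fun h0 => hX0 (Subtype.ext h0)
  exact ⟨‖(X : E)‖⁻¹ • (X : E), Submodule.smul_mem _ _ X.2, norm_smul_inv_norm hX0'⟩

theorem not_isIntrinsicallyHomogeneous (h : IsCliffordSystem P) {n : ℕ}
    (hd : 3 + 2 + n = Module.finrank ℝ E) (hd8 : 8 < Module.finrank ℝ E) :
    ¬ IsIntrinsicallyHomogeneous n (focalM1 P) := by
  intro hhom
  have : Nontrivial E := Module.nontrivial_of_finrank_pos (R := ℝ) (by omega)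
  obtain ⟨x, hx⟩ := h.omegaSet_nonempty
  obtain ⟨y, hyM, hy⟩ := h.exists_notMem_omegaSet hd8
  obtain ⟨f, hf, rfl⟩ := hhom x hx.1 y hyM
  obtain ⟨X, hX, hX1⟩ := h.exists_unit_mem_asymptoticSpace hx
  have hX0 : X ≠ 0 := fun h0 => by simp [h0] at hX1
  obtain ⟨Y, hY, hY0⟩ :=
    h.exists_mem_asymptoticSpace_of_isometry (by norm_num) hd hf hx.1 hX hX0
  exact hy (h.mem_omegaSet_of_mem_asymptoticSpace hyM hY hY0)

end IsCliffordSystem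

end RicciFour

end OTFKM

end

/-- Multiplicities `(m₁, m₂) = (m, l - m - 1) = (3, 4k)` with `m₂ > 0` mean `m = 3`, `l = 4k + 4`
and `k ≥ 1`; the dimension of `M₁` is `2l - m - 2 = 2l - 5`. -/
theorem proposition1p2 (k l : ℕ) (hk : 1 ≤ k) (hl : l = 4 * k + 4)
    (P : Fin (3 + 1) → EuclideanSpace ℝ (Fin (2 * l)) →L[ℝ] EuclideanSpace ℝ (Fin (2 * l)))
    (hP : OTFKM.IsCliffordSystem P) :
    -- `M₁` is a submanifold which is not intrinsically homogeneous
    OTFKM.IsSmoothSubmanifold (2 * l - 5) (OTFKM.focalM1 P) ∧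
    ¬ OTFKM.IsIntrinsicallyHomogeneous (2 * l - 5) (OTFKM.focalM1 P) ∧
    -- the maximum of the Ricci curvature over all unit tangent vectors of `M₁` is `2l - 6`
    IsGreatest {r : ℝ | ∃ x ∈ OTFKM.focalM1 P, ∃ X ∈ OTFKM.tangentSpace (OTFKM.focalM1 P) x,
      ‖X‖ = 1 ∧ r = OTFKM.ricciCurvature (2 * l - 5) (OTFKM.focalM1 P) x X} (2 * (l : ℝ) - 6) ∧
    -- it is attained exactly at the points of `Ω`
    (∀ x ∈ OTFKM.focalM1 P,
      (∃ X ∈ OTFKM.tangentSpace (OTFKM.focalM1 P) x, ‖X‖ = 1 ∧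
        OTFKM.ricciCurvature (2 * l - 5) (OTFKM.focalM1 P) x X = 2 * (l : ℝ) - 6) ↔
      x ∈ OTFKM.omegaSet P) ∧
    -- `Ω` is a nonempty proper subset of `M₁`
    (OTFKM.omegaSet P).Nonempty ∧ OTFKM.omegaSet P ⊂ OTFKM.focalM1 P ∧
    -- `Ω` in terms of the second fundamental form of `M₁`
    OTFKM.omegaSet P = {x | x ∈ OTFKM.focalM1 P ∧
      ∃ N : Fin 4 → EuclideanSpace ℝ (Fin (2 * l)),
        OTFKM.IsOrthonormalNormal (OTFKM.focalM1 P) x N ∧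
        3 ≤ Module.finrank ℝ (OTFKM.commonKernel (OTFKM.focalM1 P) x N)} ∧
    -- the common kernels have dimension at most three
    (∀ x ∈ OTFKM.focalM1 P, ∀ N : Fin 4 → EuclideanSpace ℝ (Fin (2 * l)),
      OTFKM.IsOrthonormalNormal (OTFKM.focalM1 P) x N →
        Module.finrank ℝ (OTFKM.commonKernel (OTFKM.focalM1 P) x N) ≤ 3) ∧
    -- at the points of `Ω` the common kernel is three-dimensional, and its unit vectors are the
    -- directions in which the maximum is attained
    (∀ x ∈ OTFKM.omegaSet P, ∀ N : Fin 4 → EuclideanSpace ℝ (Fin (2 * l)),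
      OTFKM.IsOrthonormalNormal (OTFKM.focalM1 P) x N →
        Module.finrank ℝ (OTFKM.commonKernel (OTFKM.focalM1 P) x N) = 3 ∧
        ∀ X : OTFKM.tangentSpace (OTFKM.focalM1 P) x, ‖X‖ = 1 →
          (OTFKM.ricciCurvature (2 * l - 5) (OTFKM.focalM1 P) x X = 2 * (l : ℝ) - 6 ↔
            X ∈ OTFKM.commonKernel (OTFKM.focalM1 P) x N)) := by
  have hfin : Module.finrank ℝ (EuclideanSpace ℝ (Fin (2 * l))) = 2 * l := by simp
  have hd : 3 + 2 + (2 * l - 5)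
      = Module.finrank ℝ (EuclideanSpace ℝ (Fin (2 * l))) := by rw [hfin]; omega
  have hd8 : 8 < Module.finrank ℝ (EuclideanSpace ℝ (Fin (2 * l))) := by rw [hfin]; omega
  have hnt : Nontrivial (EuclideanSpace ℝ (Fin (2 * l))) :=
    Module.nontrivial_of_finrank_pos (R := ℝ) (by omega)
  -- the maximum `n - 1` for `n = 2l - 5`, where the subtraction of natural numbers is exact
  have hcast : (2 * (l : ℝ) - 6) = ((2 * l - 5 : ℕ) : ℝ) - 1 := by
    rw [Nat.cast_sub (by omega)]
    push_cast
    ring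
  have hm : 1 ≤ 3 := by norm_num
  have hmax : ∀ x ∈ OTFKM.omegaSet P, ∃ X ∈ OTFKM.tangentSpace (OTFKM.focalM1 P) x, ‖X‖ = 1 ∧
      OTFKM.ricciCurvature (2 * l - 5) (OTFKM.focalM1 P) x X = 2 * (l : ℝ) - 6 := by
    intro x hx
    obtain ⟨X, hX, hX1⟩ := hP.exists_unit_mem_asymptoticSpace hx
    have hXT := (OTFKM.mem_asymptoticSpace.1 hX).1
    exact ⟨X, hXT, hX1, by rw [hcast, hP.ricciCurvature_eq_iff hm hd hx.1 hXT hX1]; exact hX⟩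
  refine ⟨hP.isSmoothSubmanifold_focalM1 hd, hP.not_isIntrinsicallyHomogeneous hd hd8,
    ⟨?_, ?_⟩, ?_, hP.omegaSet_nonempty, ⟨fun x hx => hx.1, ?_⟩, ?_, ?_, ?_⟩
  · obtain ⟨x, hx⟩ := hP.omegaSet_nonempty
    obtain ⟨X, hXT, hX1, hX⟩ := hmax x hx
    exact ⟨x, hx.1, X, hXT, hX1, hX.symm⟩
  · rintro _ ⟨x, hx, X, hXT, hX1, rfl⟩
    rw [hcast]
    exact hP.ricciCurvature_le hm hd hx hXT hX1
  · refine fun x hx => ⟨?_, hmax x⟩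
    rintro ⟨X, hXT, hX1, hX⟩
    rw [hcast, hP.ricciCurvature_eq_iff hm hd hx hXT hX1] at hX
    exact hP.mem_omegaSet_of_mem_asymptoticSpace hx hX fun h0 => by simp [h0] at hX1
  · obtain ⟨y, hyM, hy⟩ := hP.exists_notMem_omegaSet hd8
    exact fun hle => hy (hle hyM)
  · ext x
    constructor
    · intro hx
      refine ⟨hx.1, fun α => P α x, hP.isOrthonormalNormal hx.1, ?_⟩
      rw [hP.finrank_commonKernel hx.1 (hP.isOrthonormalNormal hx.1),
        hP.finrank_asymptoticSpace_of_mem_omegaSet hx]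
    · rintro ⟨hx, N, hN, h3⟩
      rw [hP.finrank_commonKernel hx hN] at h3
      have : Nontrivial (OTFKM.asymptoticSpace P x) :=
        Module.nontrivial_of_finrank_pos (R := ℝ) (by omega)
      obtain ⟨X, hX0⟩ := exists_ne (0 : OTFKM.asymptoticSpace P x)
      exact hP.mem_omegaSet_of_mem_asymptoticSpace hx X.2 fun h0 => hX0 (Subtype.ext h0)
  · intro x hx N hN
    rw [hP.finrank_commonKernel hx hN]
    exact hP.finrank_asymptoticSpace_le hx
  · intro x hx N hN
    refine ⟨?_, fun X hX1 => ?_⟩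
    · rw [hP.finrank_commonKernel hx.1 hN, hP.finrank_asymptoticSpace_of_mem_omegaSet hx]
    · rw [hcast, hP.ricciCurvature_eq_iff hm hd hx.1 X.2 hX1, ← hP.map_commonKernel hx.1 hN]
      constructor
      · rintro ⟨Y, hY, hYX⟩
        rwa [← Subtype.ext hYX]
      · exact fun hX => ⟨X, hX, rfl⟩
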